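/- All Borel spaces are standard. A Borel groupoid $G$ has unit space $G^{(0)}$, range and source maps $r,s$, and Borel structure maps; $G^x=r^{-1}(x)$, and for $E\subset G^{(0)}$ put $G|_E=\{\gamma: r(\gamma)\in E,\ s(\gamma)\in E\}$ and $G^x_E=\{\gamma : r(\gamma)=x,\ s(\gamma)\in E\}$. Let $C$ be the measure class of a probability measure on $G$, and $r(C)$ its image on $G^{(0)}$; "null", "conull" and "positive measure" for sets of units refer to $r(C)$. An inessential reduction of $G$ is $G|_U$ with $U\subset G^{(0)}$ a conull Borel set. The pair $(G,C)$ is a measured groupoid if $C$ is invariant under inversion and contains a probability measure $\nu$ whose disintegration $(\nu^x)_{x\in G^{(0)}}$ along $r$ satisfies $\gamma\nu^{s(\gamma)}\sim\nu^{r(\gamma)}$ for all $\gamma$ in some inessential reduction. It is $r$-discrete if some inessential reduction has countable $r$-fibres, and ergodic if every invariant Borel subset of $G^{(0)}$ is null or conull. A representation $L$ of $(G,C)$ in a complex (separable) Hilbert bundle $\mathcal H=(\mathcal H(x))_{x\in G^{(0)}}$ is a Borel family of operators $L(\gamma):\mathcal H(s(\gamma))\to\mathcal H(r(\gamma))$ which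 on some inessential reduction are unitary and satisfy $L(\gamma_1\gamma_2)=L(\gamma_1)L(\gamma_2)$. A unit section is a Borel section $\xi$ of $\mathcal H$ with $\|\xi(x)\|=1$ for almost every $x$; put $c_L(\xi)(\gamma)=\xi(r(\gamma))-L(\gamma)\xi(s(\gamma))$. Then $(G,C)$ has property $T$ if every representation $L$ that admits a sequence of unit sections $\xi_n$ with $c_L(\xi_n)\to 0$ $C$-a.e. admits a unit section $\xi$ with $c_L(\xi)=0$ $C$-a.e. A real conditionally negative definite function on $(G,C)$ is a Borel function $\psi:G\to\mathbb R$ such that, for some inessential reduction $G|_U$: $\psi(x)=0$ for $x\in U$; $\psi(\gamma^{-1})=\psi(\gamma)$ for $\gamma\in G|_U$; and $\sum_{i,j=1}^n\lambda_i\lambda_j\,\psi(\gamma_i^{-1}\gamma_j)\le 0$ for all $x\in U$, $n\ge2$, $\gamma_1,\dots,\gamma_n\in G^x_U$ and $\lambda_1,\dots,\lambda_n\in\mathbb R$ with $\sum_i\lambda_i=0$. **Theorem.** Let $(G,C)$ be an ergodic $r$-discrete measured groupoid. The following conditions are equivalent: (i) $(G,C)$ has property $T$. (ii) For every real conditionally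 negative definite function $\psi$ on $(G,C)$ there exists a Borel subset $E\subset G^{(0)}$ of positive measure such that the restriction of $\psi$ to $G|_E$ is bounded. (iii) For every real conditionally negative definite function $\psi$ on $(G,C)$ there exists a Borel subset $E\subset G^{(0)}$ of positive measure such that $\sup_{\gamma\in G^x_E}|\psi(\gamma)|<+\infty$ for every $x\in E$. -/

import Mathlib

open CategoryTheory MeasureTheory ProbabilityTheory Filter Topology

universe u v w

namespace MeasGpd

/-! ### Borel groupoids

The algebraic groupoid is Mathlib's `CategoryTheory.Groupoid` on the unit space `X`. A morphism
`γ : x ⟶ y` is a groupoid element with range `r(γ) = x` and source `s(γ) = y`; with this convention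
the groupoid product `γ₁γ₂` (defined when `s(γ₁) = r(γ₂)`) is `γ₁ ≫ γ₂`. -/

/-- The set of all elements of the groupoid. -/
structure Arr (X : Type u) [Groupoid.{w} X] where
  /-- the range of the element -/
  rng : X
  /-- the source of the element -/
  src : X
  /-- the element itself -/
  hom : rng ⟶ src

namespace Arr

variable {X : Type u} [Groupoid.{w} X]

/-- The unit at `x`. -/
def unit (x : X) : Arr X := ⟨x, x, 𝟙 x⟩

/-- The inverse of an element. -/
def inverse (a : Arr X) : Arr X := ⟨a.src, a.rng, Groupoid.inv a.hom⟩

/-- The product `ab` of a composable pair, `s(a) = r(b)`. -/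
def comp (a b : Arr X) (h : a.src = b.rng) : Arr X := ⟨a.rng, b.src, a.hom ≫ eqToHom h ≫ b.hom⟩

/-- The elements of the reduction `G|_U`. -/
def reduction (U : Set X) : Set (Arr X) := {a | a.rng ∈ U ∧ a.src ∈ U}

end Arr

/-- The structure maps of the groupoid are Borel. (It is applied to standard Borel structures on the
unit space and on the set of elements.) -/
class IsBorelGroupoid (X : Type u) [Groupoid.{w} X] [MeasurableSpace X]
    [MeasurableSpace (Arr X)] : Prop where
  measurable_rng : Measurable (Arr.rng : Arr X → X)
  measurable_src : Measurable (Arr.src : Arr X → X)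
  measurable_unit : Measurable (Arr.unit : X → Arr X)
  measurable_inverse : Measurable (Arr.inverse : Arr X → Arr X)
  measurable_comp :
    Measurable fun p : {p : Arr X × Arr X // p.1.src = p.2.rng} => p.1.1.comp p.1.2 p.2

section Measured

variable {X : Type u} [Groupoid.{w} X] [MeasurableSpace X] [MeasurableSpace (Arr X)]

/-- The image `r_* ν` of `ν` on the unit space. -/
noncomputable def unitMeasure (ν : Measure (Arr X)) : Measure X := ν.map Arr.rng

/-- `U` is a conull Borel set of units, so that `G|_U` is an inessential reduction. -/
def IsConullUnits (ν : Measure (Arr X)) (U : Set X) : Prop :=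
  MeasurableSet U ∧ unitMeasure ν Uᶜ = 0

/-- The measure class of `ν` is symmetric. -/
def IsSymmetricClass (ν : Measure (Arr X)) : Prop :=
  ν ≪ ν.map Arr.inverse ∧ ν.map Arr.inverse ≪ ν

/-- The measure class of `ν` is invariant: it contains a probability measure `ν'` with a
disintegration `x ↦ κ x` along the range map such that `γ κ^{s(γ)}` is equivalent to `κ^{r(γ)}`
for all `γ` in some inessential reduction. Here `(γ κ^{s(γ)})(A) = κ^{s(γ)} {a | γ a ∈ A}`. -/
def IsInvariantClass (ν : Measure (Arr X)) : Prop :=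
  ∃ ν' : Measure (Arr X), IsProbabilityMeasure ν' ∧ ν' ≪ ν ∧ ν ≪ ν' ∧
    ∃ κ : Kernel X (Arr X), IsMarkovKernel κ ∧
      (∀ᵐ x ∂(unitMeasure ν'), κ x {a | a.rng ≠ x} = 0) ∧
      (unitMeasure ν').bind κ = ν' ∧
      ∃ U : Set X, IsConullUnits ν U ∧ ∀ γ ∈ Arr.reduction U, ∀ A : Set (Arr X), MeasurableSet A →
        (κ γ.src {a | ∃ h : γ.src = a.rng, γ.comp a h ∈ A} = 0 ↔ κ γ.rng A = 0)

/-- `(G, C)` is a measured groupoid, where `C` is the measure class of the probability measure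
`ν`. -/
structure IsMeasuredGroupoid (ν : Measure (Arr X)) : Prop where
  symmetric : IsSymmetricClass ν
  invariant : IsInvariantClass ν

/-- Every invariant Borel set of units is null or conull. -/
def IsErgodic (ν : Measure (Arr X)) : Prop :=
  ∀ A : Set X, MeasurableSet A → (∀ γ : Arr X, γ.rng ∈ A ↔ γ.src ∈ A) →
    unitMeasure ν A = 0 ∨ unitMeasure ν Aᶜ = 0

/-- Some inessential reduction has countable range fibres. -/
def IsRDiscrete (ν : Measure (Arr X)) : Prop :=
  ∃ U : Set X, IsConullUnits ν U ∧ ∀ x ∈ U, {a : Arr X | a.rng = x ∧ a.src ∈ U}.Countable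

/-- Real conditionally negative definite functions on the measured groupoid: Borel functions whose
restriction to some inessential reduction is conditionally negative definite. -/
structure IsCondNegDef (ν : Measure (Arr X)) (ψ : Arr X → ℝ) : Prop where
  measurable : Measurable ψ
  exists_reduction : ∃ U : Set X, IsConullUnits ν U ∧
    (∀ x ∈ U, ψ (Arr.unit x) = 0) ∧
    (∀ γ ∈ Arr.reduction U, ψ γ.inverse = ψ γ) ∧
    ∀ x ∈ U, ∀ n : ℕ, 2 ≤ n → ∀ y : Fin n → X, (∀ i, y i ∈ U) → ∀ γ : ∀ i, x ⟶ y i,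
      ∀ c : Fin n → ℝ, ∑ i, c i = 0 →
        ∑ i, ∑ j, c i * c j * ψ ⟨y i, y j, Groupoid.inv (γ i) ≫ γ j⟩ ≤ 0

end Measured

/-! ### Hilbert bundles and representations -/

/-- The total space `X * H` of a family of spaces. -/
structure Total {X : Type u} (H : X → Type v) where
  /-- the base point -/
  base : X
  /-- the vector in the fibre over the base point -/
  vec : H base

/-- A fundamental sequence of sections of a family of Hilbert spaces, for a given Borel structure on
the total space. Separation of points is understood in each fibre. -/
structure IsFundamentalSeq {X : Type u} [MeasurableSpace X] {H : X → Type v}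
    [∀ x, NormedAddCommGroup (H x)] [∀ x, InnerProductSpace ℂ (H x)] [MeasurableSpace (Total H)]
    (ξ : ℕ → ∀ x, H x) : Prop where
  measurable : ∀ n, Measurable fun x => (⟨x, ξ n x⟩ : Total H)
  measurable_inner : ∀ n, Measurable fun z : Total H => inner ℂ (ξ n z.base) z.vec
  measurable_gram : ∀ m n, Measurable fun x => inner ℂ (ξ m x) (ξ n x)
  separates : ∀ x, ∀ v w : H x, (∀ n, inner ℂ (ξ n x) v = inner ℂ (ξ n x) w) → v = w

/-- A (complex) Hilbert bundle on the Borel space `X`. -/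
structure HilbertBundle (X : Type u) [MeasurableSpace X] where
  /-- the fibres -/
  fiber : X → Type v
  [normed : ∀ x, NormedAddCommGroup (fiber x)]
  [innerProduct : ∀ x, InnerProductSpace ℂ (fiber x)]
  [complete : ∀ x, CompleteSpace (fiber x)]
  /-- the Borel structure of the total space -/
  [borel : MeasurableSpace (Total fiber)]
  [standard : StandardBorelSpace (Total fiber)]
  measurableSet_iff : ∀ E : Set X,
    MeasurableSet E ↔ MeasurableSet {z : Total fiber | z.base ∈ E}
  exists_fundamental : ∃ ξ : ℕ → ∀ x, fiber x, IsFundamentalSeq ξ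

attribute [instance] HilbertBundle.normed HilbertBundle.innerProduct HilbertBundle.complete
  HilbertBundle.borel HilbertBundle.standard

/-- Borel sections of a Hilbert bundle. -/
def HilbertBundle.IsBorelSection {X : Type u} [MeasurableSpace X] (H : HilbertBundle.{u, v} X)
    (ξ : ∀ x, H.fiber x) : Prop :=
  Measurable fun x => (⟨x, ξ x⟩ : Total H.fiber)

section Representations

variable {X : Type u} [Groupoid.{w} X] [MeasurableSpace X] [MeasurableSpace (Arr X)]

/-- Unit sections: Borel sections of norm one almost everywhere. -/
def IsUnitSection (ν : Measure (Arr X)) (H : HilbertBundle.{u, v} X) (ξ : ∀ x, H.fiber x) : Prop :=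
  H.IsBorelSection ξ ∧ ∀ᵐ x ∂(unitMeasure ν), ‖ξ x‖ = 1

/-- A representation of the measured groupoid in a Hilbert bundle `H`: a Borel family of operators
`L(γ) : H(s(γ)) → H(r(γ))` which on some inessential reduction `G|_U` is multiplicative and consists
of isometries of `H(s(γ))` onto `H(r(γ))`. The values outside `G|_U` are irrelevant, and are only
asked to be bounded operators. -/
structure Representation (ν : Measure (Arr X)) (H : HilbertBundle.{u, v} X) where
  /-- the operator `L(γ)` -/
  op : ∀ {x y : X}, (x ⟶ y) → (H.fiber y →L[ℂ] H.fiber x)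
  measurable_op : ∃ ξ : ℕ → ∀ x, H.fiber x, IsFundamentalSeq ξ ∧
    ∀ m n, Measurable fun a : Arr X => inner ℂ (op a.hom (ξ n a.src)) (ξ m a.rng)
  exists_reduction : ∃ U : Set X, IsConullUnits ν U ∧
    (∀ x ∈ U, ∀ y ∈ U, ∀ γ : x ⟶ y, Isometry (op γ) ∧ Function.Surjective (op γ)) ∧
    ∀ x ∈ U, ∀ y ∈ U, ∀ z ∈ U, ∀ (γ₁ : x ⟶ y) (γ₂ : y ⟶ z), op (γ₁ ≫ γ₂) = (op γ₁).comp (op γ₂)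

variable {ν : Measure (Arr X)} {H : HilbertBundle.{u, v} X}

/-- The coboundary `c_L(ξ)(γ) = ξ(r(γ)) - L(γ) ξ(s(γ))`. -/
def Representation.cobdry (L : Representation ν H) (ξ : ∀ x, H.fiber x) (a : Arr X) :
    H.fiber a.rng :=
  ξ a.rng - L.op a.hom (ξ a.src)

/-- `L` contains a unit invariant section. -/
def Representation.HasUnitInvariantSection (L : Representation ν H) : Prop :=
  ∃ ξ : ∀ x, H.fiber x, IsUnitSection ν H ξ ∧ ∀ᵐ a ∂ν, L.cobdry ξ a = 0

/-- `L` almost contains unit invariant sections. -/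
def Representation.AlmostHasUnitInvariantSections (L : Representation ν H) : Prop :=
  ∃ ξ : ℕ → ∀ x, H.fiber x, (∀ n, IsUnitSection ν H (ξ n)) ∧
    ∀ᵐ a ∂ν, Tendsto (fun n => L.cobdry (ξ n) a) atTop (𝓝 0)

/-- Property T. The fibres of the Hilbert bundles range over the (arbitrary) universe `v`. -/
def PropertyT (ν : Measure (Arr X)) : Prop :=
  ∀ (H : HilbertBundle.{u, v} X) (L : Representation ν H),
    L.AlmostHasUnitInvariantSections → L.HasUnitInvariantSection

end Representations

end MeasGpd

namespace MeasGpd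

/-! ### Positive semidefinite kernels -/

section Kernels

open scoped ComplexOrder Matrix

variable {ι : Type*}

/-! Discreteness turns almost-everywhere statements into statements about every element. By
invariance, `γ` is an atom of the fibre measure at `r(γ)` exactly when the unit at `s(γ)` is an atom
of its own fibre measure. Countable fibres and symmetry of the class then give an inessential
reduction all of whose elements are atoms (`exists_isChargedReduction`). There a property that holds
a.e. holds everywhere on a smaller reduction, and Borel sets of elements have Borel range images and
Borel enumerations of their fibres.

Property T gives fibrewise boundedness (`exists_fibrewise_bounded_of_propertyT`). By Schoenberg, the
kernels `exp(-ψ/(n+1))` are positive definite; their GNS spaces, summed over `n`, carry a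
representation with vectors `V n γ` in the fibre over `r(γ)`, and the sections `V n (𝟙 x)` are
almost invariant. An invariant unit section `η` cannot be orthogonal to all these vectors, so for
some `n` the coefficient of `η` along `V n (𝟙 x)` is bounded below on a set `E` of positive measure.
By invariance the same bound holds along `V n γ` for `γ` with source in `E`. If `ψ` were unbounded
on such a fibre, some of these unit vectors would tend weakly to zero, a contradiction.

Fibrewise boundedness gives boundedness: cut `E` into the countably many Borel sets where the fibre
bound is at most `n` (`exists_bounded_of_fibrewise_bounded`).

Boundedness gives property T (`propertyT_of_bounded`). For a fast subsequence of almost invariant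
unit sections, `∑ 2^k ‖c(ξ_k)‖²` is finite and conditionally negative definite. A bound for it on
`G|_E` makes some `ξ_k` move by at most `1/2` on `G|_E`. By ergodicity almost every unit is joined
to `E`. The translates of `ξ_k` to such a unit form a set permuted by the groupoid, and the point of
least norm in its closed midpoint hull is equivariant and nonzero
(`Representation.hasUnitInvariantSection_of_norm_cobdry_le`). -/

theorem posSemidef_of_tendsto {A : ℕ → Matrix ι ι ℂ} {B : Matrix ι ι ℂ}
    (hA : ∀ k, (A k).PosSemidef) (h : ∀ i j, Tendsto (fun k => A k i j) atTop (𝓝 (B i j))) :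
    B.PosSemidef := by
  refine ⟨?_, fun f => ?_⟩
  · ext i j
    refine tendsto_nhds_unique ?_ (h i j)
    have h1 : ∀ k, A k i j = star (A k j i) := fun k => ((hA k).isHermitian.apply i j).symm
    simp only [h1, Matrix.conjTranspose_apply]
    exact (h j i).star
  · refine ge_of_tendsto' (x := atTop) ?_ fun k => (hA k).2 f
    exact tendsto_finsetSum _ fun i _ => tendsto_finsetSum _ fun j _ =>
      ((h i j).const_mul _).mul_const _

theorem posSemidef_rankOne (a : ι → ℂ) :
    (Matrix.of fun i j => star (a i) * a j).PosSemidef := by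
  refine ⟨by ext i j; simp [mul_comm], fun f => ?_⟩
  have h : (f.sum fun i xi => f.sum fun j xj =>
      star xi * (Matrix.of fun i j => star (a i) * a j) i j * xj) =
      star (f.sum fun i xi => a i * xi) * f.sum fun i xi => a i * xi := by
    simp only [Finsupp.sum, star_sum, Finset.sum_mul_sum, Matrix.of_apply, star_mul]
    refine Finset.sum_congr rfl fun i _ => Finset.sum_congr rfl fun j _ => by ring
  rw [h]
  exact star_mul_self_nonneg _

/-- The Schur product theorem, iterated; with the power series it yields entrywise exponentials. -/
theorem posSemidef_entrywise_pow {A : Matrix ι ι ℂ} (hA : A.PosSemidef) (k : ℕ) :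
    (Matrix.of fun i j => A i j ^ k).PosSemidef := by
  induction k with
  | zero => simpa using posSemidef_rankOne (fun _ : ι => (1 : ℂ))
  | succ k ih =>
    have h : (Matrix.of fun i j => A i j ^ (k + 1)) = (Matrix.of fun i j => A i j ^ k) ⊙ A := by
      ext i j
      simp [pow_succ]
    rw [h]
    exact ih.hadamard hA

theorem posSemidef_entrywise_exp {A : Matrix ι ι ℂ} (hA : A.PosSemidef) :
    (Matrix.of fun i j => Complex.exp (A i j)).PosSemidef := by
  refine posSemidef_of_tendsto
    (A := fun n => ∑ k ∈ Finset.range n, ((k.factorial : ℝ)⁻¹ : ℂ) • Matrix.of fun i j => A i j ^ k)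
    (fun n => Matrix.posSemidef_sum _ fun k _ =>
      (posSemidef_entrywise_pow hA k).smul ?_) fun i j => ?_
  · rw [← Complex.ofReal_inv]
    exact_mod_cast (by positivity : (0 : ℝ) ≤ (k.factorial : ℝ)⁻¹)
  · have h := (NormedSpace.exp_series_hasSum_exp' (𝕂 := ℂ) (A i j)).tendsto_sum_nat
    rw [← Complex.exp_eq_exp_ℂ] at h
    simpa [Matrix.sum_apply] using h

/-- A symmetric real matrix with nonnegative real quadratic form is positive semidefinite over the
complex numbers. -/
theorem posSemidef_ofReal {A : ι → ι → ℝ} (hs : ∀ i j, A i j = A j i)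
    (hA : ∀ (s : Finset ι) (c : ι → ℝ), 0 ≤ ∑ i ∈ s, ∑ j ∈ s, c i * c j * A i j) :
    (Matrix.of fun i j => (A i j : ℂ)).PosSemidef := by
  refine ⟨?_, fun f => ?_⟩
  · ext i j
    simp [hs i j]
  · have key : (f.sum fun i xi => f.sum fun j xj =>
        star xi * (Matrix.of fun i j => (A i j : ℂ)) i j * xj) =
        ((∑ i ∈ f.support, ∑ j ∈ f.support, (f i).re * (f j).re * A i j +
          ∑ i ∈ f.support, ∑ j ∈ f.support, (f i).im * (f j).im * A i j : ℝ) : ℂ) := by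
      -- By symmetry of `A` the mixed terms cancel, leaving the real forms at the real and imaginary
      -- parts of `f`.
      have him : ∑ i ∈ f.support, ∑ j ∈ f.support, (f i).re * (f j).im * A i j =
          ∑ i ∈ f.support, ∑ j ∈ f.support, (f i).im * (f j).re * A i j := by
        rw [Finset.sum_comm]
        refine Finset.sum_congr rfl fun i _ => Finset.sum_congr rfl fun j _ => ?_
        rw [hs i j]; ring
      simp only [Finsupp.sum, Matrix.of_apply]
      apply Complex.ext
      · simp only [Complex.re_sum, Complex.ofReal_re, ← Finset.sum_add_distrib]
        refine Finset.sum_congr rfl fun i _ => Finset.sum_congr rfl fun j _ => ?_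
        simp; ring
      · simp only [Complex.im_sum, Complex.ofReal_im]
        rw [← sub_eq_zero] at him
        rw [← him]
        simp only [← Finset.sum_sub_distrib]
        refine Finset.sum_congr rfl fun i _ => Finset.sum_congr rfl fun j _ => ?_
        simp; ring
    rw [key]
    exact_mod_cast add_nonneg (hA _ fun i => (f i).re) (hA _ fun i => (f i).im)

/-- Passes from indexed families of length at least two to finite sets; sets with at most one
element are covered by the zero diagonal. -/
theorem condNegDef_finset {ψ : ι → ι → ℝ} (hd : ∀ i, ψ i i = 0)
    (hc : ∀ n : ℕ, 2 ≤ n → ∀ p : Fin n → ι, ∀ c : Fin n → ℝ, ∑ i, c i = 0 →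
      ∑ i, ∑ j, c i * c j * ψ (p i) (p j) ≤ 0)
    (s : Finset ι) (c : ι → ℝ) (h0 : ∑ i ∈ s, c i = 0) :
    ∑ i ∈ s, ∑ j ∈ s, c i * c j * ψ i j ≤ 0 := by
  rcases lt_or_ge s.card 2 with h | h
  · have h1 : s.card ≤ 1 := by omega
    have : ∀ i ∈ s, ∀ j ∈ s, c i * c j * ψ i j = 0 := by
      intro i hi j hj
      rw [Finset.card_le_one.1 h1 i hi j hj, hd, mul_zero]
    rw [Finset.sum_eq_zero fun i hi => Finset.sum_eq_zero fun j hj => this i hi j hj]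
  · let e := s.equivFin.symm
    have tr : ∀ f : ι → ℝ, ∑ i, f (e i) = ∑ i ∈ s, f i := fun f => by
      rw [← Finset.sum_coe_sort s f]
      exact e.sum_comp fun i => f i
    have h2 := hc _ h (fun i => e i) (fun i => c (e i)) (by rw [tr c, h0])
    rw [← tr fun i => ∑ j ∈ s, c i * c j * ψ i j]
    refine le_of_eq_of_le (Finset.sum_congr rfl fun i _ => ?_) h2
    exact (tr fun j => c (e i) * c j * ψ (e i) j).symm

/-- Schoenberg's theorem. -/
theorem posSemidef_exp_neg {ψ : ι → ι → ℝ} (hd : ∀ i, ψ i i = 0) (hs : ∀ i j, ψ i j = ψ j i)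
    (hc : ∀ (s : Finset ι) (c : ι → ℝ), ∑ i ∈ s, c i = 0 →
      ∑ i ∈ s, ∑ j ∈ s, c i * c j * ψ i j ≤ 0) {t : ℝ} (ht : 0 ≤ t) :
    (Matrix.of fun i j => (Real.exp (-(t * ψ i j)) : ℂ)).PosSemidef := by
  classical
  rcases isEmpty_or_nonempty ι with hι | ⟨⟨o⟩⟩
  · refine ⟨by ext i; exact isEmptyElim i, fun f => ?_⟩
    simp [Subsingleton.elim f 0]
  have h1 : (Matrix.of fun i j => ((t * (ψ i o + ψ j o - ψ i j) : ℝ) : ℂ)).PosSemidef := by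
    refine posSemidef_ofReal (fun i j => by rw [hs i j]; ring) fun s c => ?_
    have hos : insert o s ∩ s = s := Finset.inter_eq_right.2 (Finset.subset_insert o s)
    -- A mass at the base point `o` balances the weights to total zero. Since `o` may already lie in
    -- `s`, the weight is a difference of two indicators.
    have h2 := hc (insert o s)
      (fun i => (if i ∈ s then c i else 0) - if i = o then ∑ j ∈ s, c j else 0) (by
        simp [Finset.sum_sub_distrib, Finset.sum_ite_mem, hos])
    have h3 : ∀ f : ι → ℝ, ∑ i ∈ insert o s,
        ((if i ∈ s then c i else 0) - if i = o then ∑ j ∈ s, c j else 0) * f i =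
        ∑ i ∈ s, c i * (f i - f o) := by
      intro f
      simp [sub_mul, Finset.sum_sub_distrib, Finset.sum_ite_mem, mul_sub, Finset.sum_mul, hos]
    have h4 : ∀ d : ι → ℝ, ∑ i ∈ insert o s, ∑ j ∈ insert o s, d i * d j * ψ i j =
        ∑ i ∈ insert o s, d i * ∑ j ∈ insert o s, d j * ψ i j := fun d => by
      simp only [Finset.mul_sum, mul_assoc]
    rw [h4] at h2
    simp only [h3] at h2
    rw [← neg_nonneg] at h2
    refine le_of_le_of_eq (mul_nonneg ht h2) (Eq.symm ?_)
    simp only [Finset.mul_sum, ← Finset.sum_neg_distrib, ← Finset.sum_sub_distrib]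
    refine Finset.sum_congr rfl fun i _ => Finset.sum_congr rfl fun j _ => ?_
    rw [hd, hs o j]; ring
  -- `exp(-tψ(i,j))` is the rank-one factor `exp(-tψ(i,o)) exp(-tψ(j,o))` times the exponential of
  -- the matrix in `h1`.
  refine Eq.mp (congrArg _ ?_) ((posSemidef_rankOne
    fun i => (Real.exp (-(t * ψ i o)) : ℂ)).hadamard (posSemidef_entrywise_exp h1))
  ext i j
  simp only [Matrix.of_apply, Matrix.hadamard_apply, RCLike.star_def, Complex.conj_ofReal]
  rw [← Complex.ofReal_exp, ← Complex.ofReal_mul, ← Complex.ofReal_mul, ← Real.exp_add,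
    ← Real.exp_add]
  congr 2; ring

/-- The direct sum of a sequence of positive semidefinite kernels. -/
theorem posSemidef_directSum {κ : Type*} {A : ℕ → Matrix ι ι ℂ} (hA : ∀ n, (A n).PosSemidef)
    (d : κ → ℕ) (p : κ → ι) :
    (Matrix.of fun a b => if d a = d b then A (d a) (p a) (p b) else 0).PosSemidef := by
  -- Each block is cut out by a rank-one indicator; every entry of the partial sums is eventually
  -- constant.
  refine posSemidef_of_tendsto (A := fun n => ∑ k ∈ Finset.range n,
    (Matrix.of fun a b => star (if d a = k then (1 : ℂ) else 0) * (if d b = k then 1 else 0)) ⊙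
      (A k).submatrix p p)
    (fun n => Matrix.posSemidef_sum _ fun k _ =>
      (posSemidef_rankOne _).hadamard ((hA k).submatrix p)) fun a b => ?_
  refine tendsto_const_nhds.congr' ?_
  filter_upwards [eventually_gt_atTop (d a)] with n hn
  rw [Matrix.sum_apply, Finset.sum_eq_single (d a)]
  · by_cases h : d b = d a
    · simp [h]
    · simp [h, Ne.symm h]
  · intro k _ hk
    simp [Ne.symm hk]
  · intro h
    exact absurd (Finset.mem_range.2 hn) h

end Kernels

/-! ### Hilbert spaces -/

section Hilbert

/-- The Gelfand–Naimark–Segal construction for a positive semidefinite kernel on `ℕ`, with a Hilbert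
space in an arbitrary universe. -/
structure GNS (K : Matrix ℕ ℕ ℂ) where
  /-- the Hilbert space -/
  space : Type v
  [normed : NormedAddCommGroup space]
  [innerProduct : InnerProductSpace ℂ space]
  [complete : CompleteSpace space]
  /-- the generating vectors -/
  vec : ℕ → space
  inner_vec : ∀ i j, inner ℂ (vec i) (vec j) = K i j
  dense_span : Dense (Submodule.span ℂ (Set.range vec) : Set space)

open scoped ComplexOrder in
theorem nonempty_gns {K : Matrix ℕ ℕ ℂ} (hK : K.PosSemidef) : Nonempty (GNS.{v} K) := by
  -- The Hilbert space is the reproducing kernel space of `K`, with scalars read as operators on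
  -- `ℂ`; lifting the index set puts it in the universe `v`.
  let K' : Matrix (ULift.{v} ℕ) (ULift.{v} ℕ) (ℂ →L[ℂ] ℂ) :=
    Matrix.of fun i j => K i.down j.down • ContinuousLinearMap.id ℂ ℂ
  have hK1 : K'.PosSemidef := by
    refine ((RKHS.posSemidef_tfae (K := K')).out 0 2).2 (And.intro ?_ fun f => ?_)
    · ext i j
      simp only [K', Matrix.conjTranspose_apply, Matrix.of_apply, star_smul]
      rw [hK.isHermitian.apply]
      simp [ContinuousLinearMap.star_eq_adjoint, ContinuousLinearMap.adjoint_id]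
    · have h1 := (hK.submatrix (ULift.down : ULift.{v} ℕ → ℕ)).2 f
      rw [Finsupp.sum_comm] at h1
      have h2 := (Complex.le_def.1 h1).1
      rw [Complex.zero_re] at h2
      refine le_of_le_of_eq h2 (Eq.symm ?_)
      simp only [Finsupp.sum, map_sum, RCLike.re_to_complex, Complex.re_sum]
      refine Finset.sum_congr rfl fun i _ => Finset.sum_congr rfl fun j _ => ?_
      simp [K']; ring
  have : Fact K'.PosSemidef := ⟨hK1⟩
  have hd := RKHS.kerFun_dense (𝕜 := ℂ) (RKHS.OfKernel K')
  refine ⟨{ space := RKHS.OfKernel K'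
            vec := fun i => RKHS.kerFun (RKHS.OfKernel K') ⟨i⟩ 1
            inner_vec := fun i j => ?_
            dense_span := ?_ }⟩
  · have h := RKHS.kernel_inner (𝕜 := ℂ) (RKHS.OfKernel K') ⟨j⟩ ⟨i⟩ (1 : ℂ) (1 : ℂ)
    rw [RKHS.OfKernel.kernel_ofKernel] at h
    rw [← h]
    have h2 := hK.isHermitian.apply i j
    simpa [K'] using h2
  · rw [Submodule.dense_iff_topologicalClosure_eq_top, ← top_le_iff, ← hd]
    refine Submodule.topologicalClosure_mono (Submodule.span_le.2 ?_)
    rintro _ ⟨i, c, rfl⟩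
    have : RKHS.kerFun (RKHS.OfKernel K') i c = c • RKHS.kerFun (RKHS.OfKernel K') ⟨i.down⟩ 1 := by
      rw [← map_smul]; simp
    rw [this]
    exact Submodule.smul_mem _ _ (Submodule.subset_span ⟨i.down, rfl⟩)

variable {H₁ H₂ : Type*} [NormedAddCommGroup H₁] [InnerProductSpace ℂ H₁]
  [NormedAddCommGroup H₂] [InnerProductSpace ℂ H₂]

theorem norm_linearCombination_eq {ι : Type*} {a : ι → H₁} {b : ι → H₂}
    (h : ∀ i j, inner ℂ (a i) (a j) = inner ℂ (b i) (b j)) (c : ι →₀ ℂ) :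
    ‖Finsupp.linearCombination ℂ a c‖ = ‖Finsupp.linearCombination ℂ b c‖ := by
  have : inner ℂ (Finsupp.linearCombination ℂ a c) (Finsupp.linearCombination ℂ a c) =
      inner ℂ (Finsupp.linearCombination ℂ b c) (Finsupp.linearCombination ℂ b c) := by
    simp only [Finsupp.linearCombination_apply, Finsupp.sum_inner, Finsupp.inner_sum, inner_smul_left,
      inner_smul_right, h]
  rw [inner_self_eq_norm_sq_to_K, inner_self_eq_norm_sq_to_K] at this
  have h2 : ‖Finsupp.linearCombination ℂ a c‖ ^ 2 = ‖Finsupp.linearCombination ℂ b c‖ ^ 2 := by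
    exact_mod_cast this
  exact (sq_eq_sq₀ (norm_nonneg _) (norm_nonneg _)).1 h2

theorem denseRange_linearCombination {ι : Type*} {a : ι → H₁}
    (ha : Dense (Submodule.span ℂ (Set.range a) : Set H₁)) :
    DenseRange (Finsupp.linearCombination ℂ a) := by
  rw [← Finsupp.range_linearCombination] at ha
  exact ha

/-- Families with the same Gram matrix are intertwined by a unitary operator. -/
theorem exists_isometry_of_gram_eq [CompleteSpace H₁] [CompleteSpace H₂] {ι : Type*} {a : ι → H₁}
    {b : ι → H₂}
    (h : ∀ i j, inner ℂ (a i) (a j) = inner ℂ (b i) (b j))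
    (ha : Dense (Submodule.span ℂ (Set.range a) : Set H₁))
    (hb : Dense (Submodule.span ℂ (Set.range b) : Set H₂)) :
    ∃ T : H₁ →L[ℂ] H₂, Isometry T ∧ Function.Surjective T ∧ ∀ i, T (a i) = b i := by
  have hda := denseRange_linearCombination ha
  let T := (Finsupp.linearCombination ℂ b).extendOfNorm (Finsupp.linearCombination ℂ a)
  have hT : ∀ c, T (Finsupp.linearCombination ℂ a c) = Finsupp.linearCombination ℂ b c :=
    LinearMap.extendOfNorm_eq hda ⟨1, fun c => by rw [norm_linearCombination_eq h, one_mul]⟩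
  have hiso : Isometry T := by
    refine AddMonoidHomClass.isometry_of_norm T fun x => ?_
    refine hda.induction_on (p := fun x => ‖T x‖ = ‖x‖) x
      (isClosed_eq (by fun_prop) (by fun_prop)) fun c => ?_
    rw [hT, norm_linearCombination_eq h]
  refine ⟨T, hiso, ?_, fun i => by simpa using hT (Finsupp.single i 1)⟩
  have hcl : IsClosed (Set.range T) := hiso.isClosedEmbedding.isClosed_range
  have hdr : Dense (Set.range T) := by
    refine (denseRange_linearCombination hb).mono ?_
    rintro _ ⟨c, rfl⟩
    exact ⟨_, hT c⟩
  rw [← Set.range_eq_univ, ← hcl.closure_eq, hdr.closure_eq]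

theorem continuousLinearMap_ext_of_dense {ι : Type*} {a : ι → H₁}
    (ha : Dense (Submodule.span ℂ (Set.range a) : Set H₁)) {S T : H₁ →L[ℂ] H₂}
    (h : ∀ i, S (a i) = T (a i)) : S = T :=
  ContinuousLinearMap.ext_on ha fun x hx => by
    obtain ⟨i, rfl⟩ := hx
    exact h i

theorem isometry_inner_map_map {T : H₁ →L[ℂ] H₂} (hT : Isometry T) (x y : H₁) :
    inner ℂ (T x) (T y) = inner ℂ x y :=
  (⟨T.toLinearMap, fun x => by simpa using hT.norm_map_of_map_zero (map_zero T) x⟩ :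
    H₁ →ₗᵢ[ℂ] H₂).inner_map_map x y

/-! ### Midpoint hulls -/

/-- The infimum of the norms of the members of a sequence. -/
noncomputable def infNorm {E : Type*} [NormedAddCommGroup E] (w : ℕ → E) : ℝ := ⨅ i, ‖w i‖

theorem infNorm_le {E : Type*} [NormedAddCommGroup E] (w : ℕ → E) (i : ℕ) : infNorm w ≤ ‖w i‖ :=
  ciInf_le ⟨0, by rintro _ ⟨i, rfl⟩; exact norm_nonneg _⟩ i

theorem infNorm_nonneg {E : Type*} [NormedAddCommGroup E] (w : ℕ → E) : 0 ≤ infNorm w :=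
  le_ciInf fun _ => norm_nonneg _

theorem exists_norm_lt_infNorm_add {E : Type*} [NormedAddCommGroup E] (w : ℕ → E) (k : ℕ) :
    ∃ i, ‖w i‖ < infNorm w + 1 / ((k : ℝ) + 1) :=
  exists_lt_of_ciInf_lt (lt_add_of_pos_right _ Nat.one_div_pos_of_nat)

theorem tendsto_norm_infNorm {E : Type*} [NormedAddCommGroup E] {w : ℕ → E} {u : ℕ → ℕ}
    (hu : ∀ k, ‖w (u k)‖ < infNorm w + 1 / ((k : ℝ) + 1)) :
    Tendsto (fun k => ‖w (u k)‖) atTop (𝓝 (infNorm w)) := by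
  refine tendsto_of_tendsto_of_tendsto_of_le_of_le tendsto_const_nhds ?_
    (fun k => infNorm_le _ _) fun k => (hu k).le
  simpa using tendsto_one_div_add_atTop_nhds_zero_nat.const_add (infNorm w)


/-- An enumeration of the smallest midpoint-closed set containing the values of `p`. -/
noncomputable def midHull (p : ℕ → H₁) : ℕ → ℕ → H₁
  | 0, i => p i
  | k + 1, i => (2⁻¹ : ℂ) • (midHull p k i.unpair.1 + midHull p k i.unpair.2)

theorem midHull_mem {p : ℕ → H₁} {S : Set H₁} (h0 : ∀ i, p i ∈ S)
    (hS : ∀ x ∈ S, ∀ y ∈ S, (2⁻¹ : ℂ) • (x + y) ∈ S) (k i : ℕ) : midHull p k i ∈ S := by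
  induction k generalizing i with
  | zero => exact h0 i
  | succ k ih => exact hS _ (ih _) _ (ih _)

theorem exists_midHull_of_le (p : ℕ → H₁) {k l : ℕ} (h : k ≤ l) (i : ℕ) :
    ∃ j, midHull p l j = midHull p k i := by
  induction l, h using Nat.le_induction with
  | base => exact ⟨i, rfl⟩
  | succ l _ ih =>
    obtain ⟨j, hj⟩ := ih
    -- A vector is the midpoint of itself with itself, so the levels increase.
    refine ⟨Nat.pair j j, ?_⟩
    simp only [midHull, Nat.unpair_pair, hj]
    rw [← two_smul ℂ (midHull p k i), smul_smul]
    norm_num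

theorem exists_midHull_midpoint (p : ℕ → H₁) (k i l j : ℕ) :
    ∃ m n, midHull p m n = (2⁻¹ : ℂ) • (midHull p k i + midHull p l j) := by
  obtain ⟨a, ha⟩ := exists_midHull_of_le p (le_max_left k l) i
  obtain ⟨b, hb⟩ := exists_midHull_of_le p (le_max_right k l) j
  exact ⟨max k l + 1, Nat.pair a b, by simp [midHull, ha, hb]⟩

theorem map_midHull (T : H₁ →L[ℂ] H₂) (p : ℕ → H₁) (k i : ℕ) :
    T (midHull p k i) = midHull (fun j => T (p j)) k i := by
  induction k generalizing i with
  | zero => rfl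
  | succ k ih => simp [midHull, ih]

/-- The family `midHull p`, with a single index. -/
noncomputable def midSeq (p : ℕ → H₁) (i : ℕ) : H₁ := midHull p i.unpair.1 i.unpair.2

theorem exists_midSeq_midpoint (p : ℕ → H₁) (i j : ℕ) :
    ∃ n, midSeq p n = (2⁻¹ : ℂ) • (midSeq p i + midSeq p j) := by
  obtain ⟨m, n, h⟩ := exists_midHull_midpoint p i.unpair.1 i.unpair.2 j.unpair.1 j.unpair.2
  exact ⟨Nat.pair m n, by simpa [midSeq] using h⟩

theorem midSeq_mem {p : ℕ → H₁} {S : Set H₁} (h0 : ∀ i, p i ∈ S)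
    (hS : ∀ x ∈ S, ∀ y ∈ S, (2⁻¹ : ℂ) • (x + y) ∈ S) (i : ℕ) : midSeq p i ∈ S :=
  midHull_mem h0 hS _ _

theorem map_midSeq_mem_range {T : H₁ →L[ℂ] H₂} {p : ℕ → H₁} {q : ℕ → H₂}
    (h : ∀ i, ∃ j, T (p i) = q j) (i : ℕ) : ∃ j, T (midSeq p i) = midSeq q j := by
  have : midSeq (fun j => T (p j)) i ∈ Set.range (midSeq q) := by
    refine midSeq_mem (fun i => ?_) ?_ i
    · obtain ⟨j, hj⟩ := h i
      exact ⟨Nat.pair 0 j, by simp [midSeq, midHull, hj]⟩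
    · rintro _ ⟨i, rfl⟩ _ ⟨j, rfl⟩
      exact exists_midSeq_midpoint q i j
  obtain ⟨j, hj⟩ := this
  exact ⟨j, by rw [midSeq, map_midHull]; exact hj.symm⟩

/-- `z` is the limit of all sequences in the midpoint hull of `p` whose norms approach the
infimum. -/
def IsMinPoint (p : ℕ → H₁) (z : H₁) : Prop :=
  ∀ u : ℕ → ℕ, Tendsto (fun k => ‖midSeq p (u k)‖) atTop (𝓝 (infNorm (midSeq p))) →
    Tendsto (fun k => midSeq p (u k)) atTop (𝓝 z)

/-- The parallelogram law: the midpoint of two members is a member, so its norm is at least the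
infimum. Hence norm-minimising sequences are Cauchy and share one limit. -/
theorem norm_sub_sq_le_of_infNorm (p : ℕ → H₁) (i j : ℕ) :
    ‖midSeq p i - midSeq p j‖ ^ 2 ≤
      2 * (‖midSeq p i‖ ^ 2 - infNorm (midSeq p) ^ 2) +
      2 * (‖midSeq p j‖ ^ 2 - infNorm (midSeq p) ^ 2) := by
  obtain ⟨n, hn⟩ := exists_midSeq_midpoint p i j
  have h1 := parallelogram_law_with_norm ℂ (midSeq p i) (midSeq p j)
  have h2 : infNorm (midSeq p) ≤ 2⁻¹ * ‖midSeq p i + midSeq p j‖ := by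
    have := infNorm_le (midSeq p) n
    rw [hn, norm_smul] at this
    simpa using this
  nlinarith [infNorm_nonneg (midSeq p)]

theorem tendsto_norm_midSeq_sub (p : ℕ → H₁) {u v : ℕ → ℕ}
    (hu : Tendsto (fun k => ‖midSeq p (u k)‖) atTop (𝓝 (infNorm (midSeq p))))
    (hv : Tendsto (fun k => ‖midSeq p (v k)‖) atTop (𝓝 (infNorm (midSeq p)))) :
    Tendsto (fun k : ℕ × ℕ => ‖midSeq p (u k.1) - midSeq p (v k.2)‖) (atTop ×ˢ atTop) (𝓝 0) := by
  have h1 : Tendsto (fun k : ℕ × ℕ =>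
      2 * (‖midSeq p (u k.1)‖ ^ 2 - infNorm (midSeq p) ^ 2) +
      2 * (‖midSeq p (v k.2)‖ ^ 2 - infNorm (midSeq p) ^ 2)) (atTop ×ˢ atTop) (𝓝 0) := by
    have hu' := hu.comp (tendsto_fst (f := (atTop : Filter ℕ)) (g := (atTop : Filter ℕ)))
    have hv' := hv.comp (tendsto_snd (f := (atTop : Filter ℕ)) (g := (atTop : Filter ℕ)))
    have := (((hu'.pow 2).sub_const (infNorm (midSeq p) ^ 2)).const_mul 2).add
      (((hv'.pow 2).sub_const (infNorm (midSeq p) ^ 2)).const_mul 2)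
    simpa using this
  have h2 : Tendsto (fun k : ℕ × ℕ => ‖midSeq p (u k.1) - midSeq p (v k.2)‖ ^ 2)
      (atTop ×ˢ atTop) (𝓝 0) :=
    squeeze_zero (fun _ => by positivity) (fun k => norm_sub_sq_le_of_infNorm p _ _) h1
  have h3 := h2.sqrt
  simpa [Real.sqrt_sq] using h3

theorem exists_isMinPoint [CompleteSpace H₁] (p : ℕ → H₁) : ∃ z, IsMinPoint p z := by
  choose u hu using exists_norm_lt_infNorm_add (midSeq p)
  have hu1 := tendsto_norm_infNorm hu
  have hcu : CauchySeq fun k => midSeq p (u k) := by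
    rw [cauchySeq_iff_tendsto_dist_atTop_0, ← prod_atTop_atTop_eq]
    simpa only [dist_eq_norm] using tendsto_norm_midSeq_sub p hu1 hu1
  obtain ⟨z, hz⟩ := cauchySeq_tendsto_of_complete hcu
  refine ⟨z, fun v hv => ?_⟩
  have hdiag : Tendsto (fun k : ℕ => (k, k)) atTop (atTop ×ˢ atTop) :=
    tendsto_id.prodMk tendsto_id
  have h1 := (tendsto_norm_midSeq_sub p hv hu1).comp hdiag
  have h2 : Tendsto (fun k => midSeq p (v k) - midSeq p (u k)) atTop (𝓝 0) :=
    tendsto_zero_iff_norm_tendsto_zero.2 h1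
  have h3 := h2.add hz
  simp only [sub_add_cancel, zero_add] at h3
  exact h3

/-- The two isometries map each hull into the other, so the infima agree and `T` carries minimising
sequences to minimising sequences. `S` serves only to compare the infima. -/
theorem IsMinPoint.map {T : H₁ →L[ℂ] H₂} (hT : Isometry T) {S : H₂ →L[ℂ] H₁} (hS : Isometry S)
    {p : ℕ → H₁} {q : ℕ → H₂} (h : ∀ i, ∃ j, T (p i) = q j) (h' : ∀ i, ∃ j, S (q i) = p j)
    {z : H₁} {z' : H₂} (hz : IsMinPoint p z) (hz' : IsMinPoint q z') : T z = z' := by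
  have nT : ∀ x, ‖T x‖ = ‖x‖ := fun x => hT.norm_map_of_map_zero (map_zero T) x
  have nS : ∀ x, ‖S x‖ = ‖x‖ := fun x => hS.norm_map_of_map_zero (map_zero S) x
  have hd : infNorm (midSeq p) = infNorm (midSeq q) := by
    apply le_antisymm
    · refine le_ciInf fun i => ?_
      obtain ⟨j, hj⟩ := map_midSeq_mem_range h' i
      rw [← nS, hj]
      exact infNorm_le _ _
    · refine le_ciInf fun i => ?_
      obtain ⟨j, hj⟩ := map_midSeq_mem_range h i
      rw [← nT, hj]
      exact infNorm_le _ _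
  choose u hu using exists_norm_lt_infNorm_add (midSeq p)
  have hu1 := tendsto_norm_infNorm hu
  choose j hj using fun i => map_midSeq_mem_range h i
  have h1 := (T.continuous.tendsto z).comp (hz u hu1)
  have h2 := hz' (fun k => j (u k)) (by simpa [← hj, nT, ← hd] using hu1)
  refine tendsto_nhds_unique h1 (h2.congr fun k => ?_)
  simp [hj]

/-- Closed balls are closed under midpoints and limits. This keeps the minimal point away from zero
when the family lies near a unit vector. -/
theorem IsMinPoint.norm_sub_le [CompleteSpace H₁] {p : ℕ → H₁} {z : H₁} (hz : IsMinPoint p z)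
    {c : H₁} {r : ℝ} (h : ∀ i, ‖p i - c‖ ≤ r) : ‖z - c‖ ≤ r := by
  choose u hu using exists_norm_lt_infNorm_add (midSeq p)
  have hu1 := tendsto_norm_infNorm hu
  refine le_of_tendsto' ((hz u hu1).sub_const c).norm fun k => ?_
  refine midSeq_mem (S := {x | ‖x - c‖ ≤ r}) h (fun x hx y hy => ?_) (u k)
  simp only [Set.mem_ofPred_eq] at hx hy ⊢
  have : (2⁻¹ : ℂ) • (x + y) - c = (2⁻¹ : ℂ) • ((x - c) + (y - c)) := by
    rw [show (x - c) + (y - c) = (x + y) - (2 : ℂ) • c by rw [two_smul]; abel, smul_sub, smul_smul]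
    norm_num
  rw [this, norm_smul]
  have h3 := norm_add_le (x - c) (y - c)
  norm_num
  linarith

end Hilbert


/-! ### Countable dense families of combinations -/

section DenseComb

variable {E : Type*} [NormedAddCommGroup E] [NormedSpace ℂ E]

/-- Combinations of a sequence of vectors with coefficients in a countable dense set. -/
noncomputable def denseComb (ζ : ℕ → E) : List (ℕ × ℕ) → E
  | [] => 0
  | p :: l => TopologicalSpace.denseSeq ℂ p.1 • ζ p.2 + denseComb ζ l

theorem denseComb_append (ζ : ℕ → E) (l m : List (ℕ × ℕ)) :
    denseComb ζ (l ++ m) = denseComb ζ l + denseComb ζ m := by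
  induction l with
  | nil => simp [denseComb]
  | cons p l ih => simp [denseComb, ih, add_assoc]

/-- The combinations form only an additive monoid, but its closure contains every scalar multiple of
each generator. Conditions on the whole span thus reduce to countably many. -/
theorem span_subset_closure_denseComb (ζ : ℕ → E) :
    (Submodule.span ℂ (Set.range ζ) : Set E) ⊆ closure (Set.range (denseComb ζ)) := by
  let S : AddSubmonoid E :=
    { carrier := Set.range (denseComb ζ)
      zero_mem' := ⟨[], rfl⟩
      add_mem' := by
        rintro _ _ ⟨l, rfl⟩ ⟨m, rfl⟩
        exact ⟨l ++ m, denseComb_append ζ l m⟩ }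
  have h1 : ∀ (c : ℂ) (n : ℕ), c • ζ n ∈ S.topologicalClosure := by
    intro c n
    have hc : c ∈ closure (Set.range (TopologicalSpace.denseSeq ℂ)) :=
      TopologicalSpace.denseRange_denseSeq ℂ c
    refine map_mem_closure (f := fun c : ℂ => c • ζ n) (by fun_prop) hc ?_
    rintro _ ⟨k, rfl⟩
    exact ⟨[(k, n)], by simp [denseComb]⟩
  intro x hx
  rw [SetLike.mem_coe, Finsupp.mem_span_range_iff_exists_finsupp] at hx
  obtain ⟨c, rfl⟩ := hx
  exact S.topologicalClosure.sum_mem fun n _ => h1 _ n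

/-- Lets a single list approximate a combination in two families at once. -/
theorem denseComb_prodMk {F : Type*} [NormedAddCommGroup F] [NormedSpace ℂ F] (ζ : ℕ → E)
    (η : ℕ → F) (l : List (ℕ × ℕ)) :
    denseComb (fun n => (ζ n, η n)) l = (denseComb ζ l, denseComb η l) := by
  induction l with
  | nil => rfl
  | cons p l ih => simp [denseComb, ih]

end DenseComb

/-! ### Vectors determined by their moments against a generating sequence -/

section Riesz

variable {E : Type*} [NormedAddCommGroup E] [InnerProductSpace ℂ E]

theorem inner_denseComb (ζ : ℕ → E) (v : E) (l : List (ℕ × ℕ)) :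
    inner ℂ v (denseComb ζ l) = denseComb (fun n => inner ℂ v (ζ n)) l := by
  induction l with
  | nil => simp [denseComb]
  | cons p l ih =>
    rw [denseComb, inner_add_right, inner_smul_right, ih]
    rfl

/-- The moment problem for a generating sequence of vectors. -/
theorem exists_inner_eq_iff [CompleteSpace E] {ζ : ℕ → E}
    (hζ : Dense (Submodule.span ℂ (Set.range ζ) : Set E)) (c : ℕ → ℂ) :
    (∃ v : E, ∀ n, inner ℂ (ζ n) v = c n) ↔
      ∃ C : ℕ, ∀ l, ‖denseComb (fun n => star (c n)) l‖ ≤ C * ‖denseComb ζ l‖ := by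
  constructor
  · rintro ⟨v, hv⟩
    obtain ⟨C, hC⟩ := exists_nat_ge ‖v‖
    refine ⟨C, fun l => ?_⟩
    have h1 : (fun n => star (c n)) = fun n => inner ℂ v (ζ n) := by
      ext n
      rw [← hv, RCLike.star_def, inner_conj_symm]
    rw [h1, ← inner_denseComb]
    exact (norm_inner_le_norm _ _).trans (by gcongr)
  · rintro ⟨C, hC⟩
    let e := Finsupp.linearCombination ℂ ζ
    let f := Finsupp.linearCombination ℂ fun n => star (c n)
    have hb : ∀ q, ‖f q‖ ≤ C * ‖e q‖ := by
      intro q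
      -- Approximating the two combinations by the same lists extends the bound from lists to the
      -- whole span; the resulting bounded functional is represented by a vector.
      have hmem : (e q, f q) ∈ closure (Set.range (denseComb fun n => (ζ n, star (c n)))) := by
        apply span_subset_closure_denseComb
        rw [SetLike.mem_coe, Finsupp.mem_span_range_iff_exists_finsupp]
        refine ⟨q, ?_⟩
        simp only [e, f, Finsupp.linearCombination_apply, Finsupp.sum]
        simp [Prod.ext_iff, Prod.fst_sum, Prod.snd_sum]
      have hcl : IsClosed {p : E × ℂ | ‖p.2‖ ≤ C * ‖p.1‖} :=
        isClosed_le (by fun_prop) (by fun_prop)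
      refine closure_minimal ?_ hcl hmem
      rintro _ ⟨l, rfl⟩
      rw [denseComb_prodMk]
      exact hC l
    let g := f.extendOfNorm e
    have hg : ∀ q, g (e q) = f q :=
      LinearMap.extendOfNorm_eq (denseRange_linearCombination hζ) ⟨C, hb⟩
    refine ⟨(InnerProductSpace.toDual ℂ E).symm g, fun n => ?_⟩
    rw [← inner_conj_symm, InnerProductSpace.toDual_symm_apply]
    have := hg (Finsupp.single n 1)
    simp only [e, f, Finsupp.linearCombination_single, one_smul] at this
    simp [this]

/-- Duality on a countable dense set: a norm bound becomes countably many conditions on moments and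
Gram data, which gives Borel norms without orthonormalising. -/
theorem norm_le_iff_denseComb {ζ : ℕ → E}
    (hζ : Dense (Submodule.span ℂ (Set.range ζ) : Set E)) (v : E) {r : ℝ} (hr : 0 ≤ r) :
    ‖v‖ ≤ r ↔ ∀ l, ‖denseComb (fun n => star (inner ℂ (ζ n) v)) l‖ ≤ r * ‖denseComb ζ l‖ := by
  have h1 : (fun n => star (inner ℂ (ζ n) v)) = fun n => inner ℂ v (ζ n) := by
    ext n
    rw [RCLike.star_def, inner_conj_symm]
  simp only [h1, ← inner_denseComb]
  refine ⟨fun h l => (norm_inner_le_norm _ _).trans (by gcongr), fun h => ?_⟩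
  have hcl : IsClosed {x : E | ‖inner ℂ v x‖ ≤ r * ‖x‖} :=
    isClosed_le (by fun_prop) (by fun_prop)
  have hd : Dense (Set.range (denseComb ζ)) := by
    rw [← dense_closure]
    exact hζ.mono (span_subset_closure_denseComb ζ)
  have h2 : ‖inner ℂ v v‖ ≤ r * ‖v‖ :=
    closure_minimal (by rintro _ ⟨l, rfl⟩; exact h l) hcl (hd v)
  rw [inner_self_eq_norm_sq_to_K, norm_pow, RCLike.norm_ofReal, abs_norm] at h2
  by_contra! hlt
  nlinarith [norm_nonneg v]

theorem dense_span_of_separates [CompleteSpace E] {ζ : ℕ → E}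
    (h : ∀ v w : E, (∀ n, inner ℂ (ζ n) v = inner ℂ (ζ n) w) → v = w) :
    Dense (Submodule.span ℂ (Set.range ζ) : Set E) := by
  rw [Submodule.dense_iff_topologicalClosure_eq_top, Submodule.topologicalClosure_eq_top_iff,
    Submodule.eq_bot_iff]
  intro v hv
  refine h v 0 fun n => ?_
  rw [inner_zero_right]
  exact (Submodule.mem_orthogonal _ _).1 hv _ (Submodule.subset_span ⟨n, rfl⟩)

theorem eq_of_forall_inner_eq {ζ : ℕ → E}
    (hζ : Dense (Submodule.span ℂ (Set.range ζ) : Set E)) {v w : E}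
    (h : ∀ n, inner ℂ (ζ n) v = inner ℂ (ζ n) w) : v = w := by
  rw [← sub_eq_zero]
  have hz : ∀ n, inner ℂ (ζ n) (v - w) = 0 := fun n => by rw [inner_sub_right, h, sub_self]
  have h1 := (norm_le_iff_denseComb hζ (v - w) le_rfl).2 fun l => by
    have : ∀ l : List (ℕ × ℕ), denseComb (fun _ : ℕ => (0 : ℂ)) l = 0 := by
      intro l
      induction l with
      | nil => rfl
      | cons p l ih => simp [denseComb, ih]
    simp [hz, this]
  simpa using h1

end Riesz

/-! ### Measurable fields of vectors -/

section Fields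

variable {Y : Type*} [MeasurableSpace Y] {K : Y → Type*} [∀ y, NormedAddCommGroup (K y)]
  [∀ y, InnerProductSpace ℂ (K y)]

theorem measurable_denseComb_complex {c : ℕ → Y → ℂ} (hc : ∀ n, Measurable (c n))
    (l : List (ℕ × ℕ)) : Measurable fun y => denseComb (fun n => c n y) l := by
  induction l with
  | nil => exact measurable_const
  | cons p l ih => exact ((hc p.2).const_mul (TopologicalSpace.denseSeq ℂ p.1)).add ih

theorem measurable_norm_denseComb {ζ : ℕ → ∀ y, K y}
    (hgram : ∀ m n, Measurable fun y => inner ℂ (ζ m y) (ζ n y)) (l : List (ℕ × ℕ)) :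
    Measurable fun y => ‖denseComb (fun n => ζ n y) l‖ := by
  have h1 : ∀ n, Measurable fun y => inner ℂ (denseComb (fun n => ζ n y) l) (ζ n y) := by
    intro n
    simp only [← inner_conj_symm _ (ζ n _), inner_denseComb]
    exact RCLike.continuous_conj.measurable.comp (measurable_denseComb_complex (hgram n) l)
  have h2 : Measurable fun y =>
      inner ℂ (denseComb (fun n => ζ n y) l) (denseComb (fun n => ζ n y) l) := by
    simp only [inner_denseComb]
    exact measurable_denseComb_complex h1 l
  have h3 := h2.norm.sqrt
  convert h3 using 2 with y
  rw [inner_self_eq_norm_sq_to_K, norm_pow, RCLike.norm_ofReal, abs_norm,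
    Real.sqrt_sq (norm_nonneg _)]

theorem measurable_norm_field {ζ : ℕ → ∀ y, K y}
    (hgram : ∀ m n, Measurable fun y => inner ℂ (ζ m y) (ζ n y))
    (hd : ∀ y, Dense (Submodule.span ℂ (Set.range fun n => ζ n y) : Set (K y)))
    {u : ∀ y, K y} (hu : ∀ n, Measurable fun y => inner ℂ (ζ n y) (u y)) :
    Measurable fun y => ‖u y‖ := by
  refine measurable_of_Iic fun r => ?_
  rcases lt_or_ge r 0 with hr | hr
  · convert MeasurableSet.empty
    ext y
    simpa using hr.trans_le (norm_nonneg (u y))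
  · have : (fun y => ‖u y‖) ⁻¹' Set.Iic r = ⋂ l : List (ℕ × ℕ),
        {y | ‖denseComb (fun n => star (inner ℂ (ζ n y) (u y))) l‖ ≤
          r * ‖denseComb (fun n => ζ n y) l‖} := by
      ext y
      simp only [Set.mem_preimage, Set.mem_Iic, Set.mem_iInter, Set.mem_ofPred_eq]
      exact norm_le_iff_denseComb (hd y) (u y) hr
    rw [this]
    refine MeasurableSet.iInter fun l => measurableSet_le ?_ ?_
    · exact (measurable_denseComb_complex
        (fun n => RCLike.continuous_conj.measurable.comp (hu n)) l).norm
    · exact (measurable_norm_denseComb hgram l).const_mul r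

theorem measurable_inner_field {ζ : ℕ → ∀ y, K y}
    (hgram : ∀ m n, Measurable fun y => inner ℂ (ζ m y) (ζ n y))
    (hd : ∀ y, Dense (Submodule.span ℂ (Set.range fun n => ζ n y) : Set (K y)))
    {u v : ∀ y, K y} (hu : ∀ n, Measurable fun y => inner ℂ (ζ n y) (u y))
    (hv : ∀ n, Measurable fun y => inner ℂ (ζ n y) (v y)) :
    Measurable fun y => inner ℂ (u y) (v y) := by
  have hI : ∀ n, Measurable fun y => inner ℂ (ζ n y) ((RCLike.I : ℂ) • v y) := fun n => by
    simp only [inner_smul_right]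
    exact (hv n).const_mul _
  have hadd : ∀ {a b : ∀ y, K y}, (∀ n, Measurable fun y => inner ℂ (ζ n y) (a y)) →
      (∀ n, Measurable fun y => inner ℂ (ζ n y) (b y)) →
      Measurable fun y => ((‖a y + b y‖ : ℝ) : ℂ) ^ 2 := fun {a b} ha hb => by
    refine (Complex.measurable_ofReal.comp (measurable_norm_field hgram hd fun n => ?_)).pow_const 2
    simp only [inner_add_right]
    exact (ha n).add (hb n)
  have hsub : ∀ {a b : ∀ y, K y}, (∀ n, Measurable fun y => inner ℂ (ζ n y) (a y)) →
      (∀ n, Measurable fun y => inner ℂ (ζ n y) (b y)) →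
      Measurable fun y => ((‖a y - b y‖ : ℝ) : ℂ) ^ 2 := fun {a b} ha hb => by
    refine (Complex.measurable_ofReal.comp (measurable_norm_field hgram hd fun n => ?_)).pow_const 2
    simp only [inner_sub_right]
    exact (ha n).sub (hb n)
  simp only [inner_eq_sum_norm_sq_div_four]
  exact (((hadd hu hv).sub (hsub hu hv)).add
    (((hsub hu hI).sub (hadd hu hI)).mul_const _)).div_const 4

end Fields

/-! ### The Borel structure of a Hilbert bundle -/

namespace HilbertBundle

variable {X : Type u} [MeasurableSpace X] (H : HilbertBundle.{u, v} X)

theorem measurable_base : Measurable fun z : Total H.fiber => z.base :=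
  fun E hE => (H.measurableSet_iff E).1 hE

variable {H}

theorem dense_span {ζ : ℕ → ∀ x, H.fiber x} (hζ : IsFundamentalSeq ζ) (x : X) :
    Dense (Submodule.span ℂ (Set.range fun n => ζ n x) : Set (H.fiber x)) :=
  dense_span_of_separates (hζ.separates x)

variable {Y : Type*} [MeasurableSpace Y] {f : Y → X}

/-- The map sending a vector to its base point and moments is Borel and injective on a standard
Borel space, hence a Borel embedding. So moments detect measurability. -/
theorem measurable_mk_iff [StandardBorelSpace X] (hf : Measurable f) {ζ : ℕ → ∀ x, H.fiber x}
    (hζ : IsFundamentalSeq ζ) {u : ∀ y, H.fiber (f y)} :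
    Measurable (fun y => (⟨f y, u y⟩ : Total H.fiber)) ↔
      ∀ n, Measurable fun y => inner ℂ (ζ n (f y)) (u y) := by
  refine ⟨fun h n => (hζ.measurable_inner n).comp h, fun h => ?_⟩
  let Φ : Total H.fiber → X × (ℕ → ℂ) := fun z => (z.base, fun n => inner ℂ (ζ n z.base) z.vec)
  have hΦ : Measurable Φ :=
    H.measurable_base.prodMk (measurable_pi_lambda _ fun n => hζ.measurable_inner n)
  have hinj : Function.Injective Φ := by
    rintro ⟨x, v⟩ ⟨y, w⟩ h
    obtain rfl : x = y := congrArg Prod.fst h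
    have h2 := congrArg Prod.snd h
    rw [hζ.separates x v w fun n => congrFun h2 n]
  refine (hΦ.measurableEmbedding hinj).measurable_comp_iff.1 ?_
  exact hf.prodMk (measurable_pi_lambda _ h)

variable [StandardBorelSpace X] (hf : Measurable f) {u v : ∀ y, H.fiber (f y)}
  (hu : Measurable fun y => (⟨f y, u y⟩ : Total H.fiber))
  (hv : Measurable fun y => (⟨f y, v y⟩ : Total H.fiber))

include hf hu in
theorem measurable_norm : Measurable fun y => ‖u y‖ := by
  obtain ⟨ζ, hζ⟩ := H.exists_fundamental
  exact measurable_norm_field (ζ := fun n y => ζ n (f y)) (K := fun y => H.fiber (f y))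
    (fun m n => (hζ.measurable_gram m n).comp hf) (fun y => dense_span hζ (f y))
    ((measurable_mk_iff hf hζ).1 hu)

include hf hu hv in
theorem measurable_inner : Measurable fun y => inner ℂ (u y) (v y) := by
  obtain ⟨ζ, hζ⟩ := H.exists_fundamental
  exact measurable_inner_field (ζ := fun n y => ζ n (f y)) (K := fun y => H.fiber (f y))
    (fun m n => (hζ.measurable_gram m n).comp hf) (fun y => dense_span hζ (f y))
    ((measurable_mk_iff hf hζ).1 hu) ((measurable_mk_iff hf hζ).1 hv)

include hf hu hv in
theorem measurable_add : Measurable fun y => (⟨f y, u y + v y⟩ : Total H.fiber) := by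
  obtain ⟨ζ, hζ⟩ := H.exists_fundamental
  refine (measurable_mk_iff hf hζ).2 fun n => ?_
  simp only [inner_add_right]
  exact ((measurable_mk_iff hf hζ).1 hu n).add ((measurable_mk_iff hf hζ).1 hv n)

include hf hu hv in
theorem measurable_sub : Measurable fun y => (⟨f y, u y - v y⟩ : Total H.fiber) := by
  obtain ⟨ζ, hζ⟩ := H.exists_fundamental
  refine (measurable_mk_iff hf hζ).2 fun n => ?_
  simp only [inner_sub_right]
  exact ((measurable_mk_iff hf hζ).1 hu n).sub ((measurable_mk_iff hf hζ).1 hv n)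

include hf hu in
theorem measurable_smul {c : Y → ℂ} (hc : Measurable c) :
    Measurable fun y => (⟨f y, c y • u y⟩ : Total H.fiber) := by
  obtain ⟨ζ, hζ⟩ := H.exists_fundamental
  refine (measurable_mk_iff hf hζ).2 fun n => ?_
  simp only [inner_smul_right]
  exact hc.mul ((measurable_mk_iff hf hζ).1 hu n)

include hf in
theorem measurable_of_tendsto {U : ℕ → ∀ y, H.fiber (f y)}
    (hU : ∀ k, Measurable fun y => (⟨f y, U k y⟩ : Total H.fiber))
    (h : ∀ y, Tendsto (fun k => U k y) atTop (𝓝 (u y))) :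
    Measurable fun y => (⟨f y, u y⟩ : Total H.fiber) := by
  obtain ⟨ζ, hζ⟩ := H.exists_fundamental
  refine (measurable_mk_iff hf hζ).2 fun n => ?_
  refine measurable_of_tendsto_metrizable (fun k => (measurable_mk_iff hf hζ).1 (hU k) n) ?_
  exact tendsto_pi_nhds.2 fun y => tendsto_const_nhds.inner (h y)

include hf in
theorem measurable_select {U : ℕ → ∀ y, H.fiber (f y)}
    (hU : ∀ k, Measurable fun y => (⟨f y, U k y⟩ : Total H.fiber)) {N : Y → ℕ}
    (hN : Measurable N) : Measurable fun y => (⟨f y, U (N y) y⟩ : Total H.fiber) := by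
  obtain ⟨ζ, hζ⟩ := H.exists_fundamental
  refine (measurable_mk_iff hf hζ).2 fun n => ?_
  exact (measurable_from_prod_countable_left
    (f := fun p : Y × ℕ => inner ℂ (ζ n (f p.1)) (U p.2 p.1))
    fun k => (measurable_mk_iff hf hζ).1 (hU k) n).comp (measurable_id.prodMk hN)

/-- A family of Hilbert spaces with a generating sequence of sections whose Gram matrix is Borel is
a Hilbert bundle. -/
theorem exists_of_generating (F : X → Type v) [∀ x, NormedAddCommGroup (F x)]
    [∀ x, InnerProductSpace ℂ (F x)] [∀ x, CompleteSpace (F x)] (ζ : ℕ → ∀ x, F x)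
    (hgram : ∀ m n, Measurable fun x => inner ℂ (ζ m x) (ζ n x))
    (hd : ∀ x, Dense (Submodule.span ℂ (Set.range fun n => ζ n x) : Set (F x))) :
    ∃ _ : MeasurableSpace (Total F), StandardBorelSpace (Total F) ∧
      (∀ E : Set X, MeasurableSet E ↔ MeasurableSet {z : Total F | z.base ∈ E}) ∧
      IsFundamentalSeq ζ := by
  let Φ : Total F → X × (ℕ → ℂ) := fun z => (z.base, fun n => inner ℂ (ζ n z.base) z.vec)
  let m0 : MeasurableSpace (Total F) := MeasurableSpace.comap Φ inferInstance
  have hΦ : Measurable Φ := comap_measurable Φ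
  have hinj : Function.Injective Φ := by
    rintro ⟨x, v⟩ ⟨y, w⟩ h
    obtain rfl : x = y := congrArg Prod.fst h
    have h2 := congrArg Prod.snd h
    rw [eq_of_forall_inner_eq (hd x) (v := v) (w := w) fun n => congrFun h2 n]
  have hrange : MeasurableSet (Set.range Φ) := by
    -- By the moment criterion, membership in the range is a countable union of countable
    -- intersections of Borel conditions; the Borel range makes the total space standard.
    have : Set.range Φ = ⋃ C : ℕ, ⋂ l : List (ℕ × ℕ), {p : X × (ℕ → ℂ) |
        ‖denseComb (fun n => star (p.2 n)) l‖ ≤ C * ‖denseComb (fun n => ζ n p.1) l‖} := by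
      ext ⟨x, c⟩
      simp only [Set.mem_iUnion, Set.mem_iInter, Set.mem_ofPred_eq]
      rw [← exists_inner_eq_iff (hd x) c]
      constructor
      · rintro ⟨⟨y, v⟩, h⟩
        obtain rfl : y = x := congrArg Prod.fst h
        exact ⟨v, fun n => congrFun (congrArg Prod.snd h) n⟩
      · rintro ⟨v, hv⟩
        exact ⟨⟨x, v⟩, Prod.ext rfl (funext hv)⟩
    rw [this]
    refine MeasurableSet.iUnion fun C => MeasurableSet.iInter fun l => measurableSet_le ?_ ?_
    · refine (measurable_denseComb_complex (c := fun n (p : X × (ℕ → ℂ)) => star (p.2 n))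
        (fun n => ?_) l).norm
      exact RCLike.continuous_conj.measurable.comp ((measurable_pi_apply n).comp measurable_snd)
    · exact ((measurable_norm_denseComb hgram l).comp measurable_fst).const_mul _
  have hbase : Measurable fun z : Total F => z.base := measurable_fst.comp hΦ
  have hmk : ∀ s : ∀ x, F x, (∀ n, Measurable fun x => inner ℂ (ζ n x) (s x)) →
      Measurable fun x => (⟨x, s x⟩ : Total F) := fun s hs => by
    refine measurable_comap_iff.2 ?_
    exact measurable_id.prodMk (measurable_pi_lambda _ hs)
  refine ⟨m0, ?_, fun E => ⟨fun hE => hbase hE, fun hE => ?_⟩, ?_⟩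
  · let e := Equiv.ofInjective Φ hinj
    obtain ⟨tr, hbr, hpr⟩ := hrange.standardBorel.polish
    let t : TopologicalSpace (Total F) := TopologicalSpace.induced e tr
    have hp : PolishSpace (Total F) := e.polishSpace_induced
    have hb : BorelSpace (Total F) := ⟨by
      rw [borel_comap, ← hbr.measurable_eq]
      exact (MeasurableSpace.comap_comp (f := Subtype.val) (g := e)).symm⟩
    infer_instance
  -- Pull back along the zero section.
  · exact hmk (fun x => 0) (fun n => by simp) hE
  · exact
      { measurable := fun n => hmk _ fun m => hgram m n
        measurable_inner := fun n => (measurable_pi_apply n).comp (measurable_snd.comp hΦ)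
        measurable_gram := hgram
        separates := fun x v w h => eq_of_forall_inner_eq (hd x) h }

end HilbertBundle

/-! ### Measurability of representations -/

section Representations

variable {X : Type u} [Groupoid.{w} X] [MeasurableSpace X] [StandardBorelSpace X]
  [MeasurableSpace (Arr X)] [IsBorelGroupoid X]
  {ν : Measure (Arr X)} {H : HilbertBundle.{u, v} X}

/-- Only coefficients between fundamental sections are known to be Borel. They show that the
adjoints applied to fundamental sections are Borel, and these can then be paired with an arbitrary
Borel section. -/
theorem Representation.measurable_op_section (L : Representation ν H) {ξ : ∀ x, H.fiber x}
    (hξ : H.IsBorelSection ξ) :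
    Measurable fun a : Arr X => (⟨a.rng, L.op a.hom (ξ a.src)⟩ : Total H.fiber) := by
  obtain ⟨ζ, hζ, hL⟩ := L.measurable_op
  have hr : Measurable (Arr.rng : Arr X → X) := IsBorelGroupoid.measurable_rng
  have hs : Measurable (Arr.src : Arr X → X) := IsBorelGroupoid.measurable_src
  refine (HilbertBundle.measurable_mk_iff hr hζ).2 fun m => ?_
  have hadj : Measurable fun a : Arr X =>
      (⟨a.src, ContinuousLinearMap.adjoint (L.op a.hom) (ζ m a.rng)⟩ : Total H.fiber) := by
    refine (HilbertBundle.measurable_mk_iff hs hζ).2 fun n => ?_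
    simp only [ContinuousLinearMap.adjoint_inner_right]
    exact hL m n
  have h2 : Measurable fun a : Arr X => (⟨a.src, ξ a.src⟩ : Total H.fiber) := Measurable.comp hξ hs
  have h3 := HilbertBundle.measurable_inner hs hadj h2
  simpa only [ContinuousLinearMap.adjoint_inner_left] using h3

theorem Representation.measurable_norm_cobdry (L : Representation ν H) {ξ : ∀ x, H.fiber x}
    (hξ : H.IsBorelSection ξ) : Measurable fun a : Arr X => ‖L.cobdry ξ a‖ := by
  have hr : Measurable (Arr.rng : Arr X → X) := IsBorelGroupoid.measurable_rng
  have h1 : Measurable fun a : Arr X => (⟨a.rng, ξ a.rng⟩ : Total H.fiber) := Measurable.comp hξ hr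
  exact HilbertBundle.measurable_norm hr
    (HilbertBundle.measurable_sub hr h1 (L.measurable_op_section hξ))

end Representations


/-! ### Discrete measured groupoids -/

section Groupoid

variable {X : Type u} [Groupoid.{w} X]

/-- Cancellation, used to apply invariance of the class to the singleton `{a}`: its preimage under
translation by `a` is the unit at the source. -/
theorem Arr.comp_eq_self_iff (a b : Arr X) :
    (∃ h : a.src = b.rng, a.comp b h = a) ↔ b = Arr.unit a.src := by
  obtain ⟨x, y, g⟩ := a
  obtain ⟨p, q, k⟩ := b
  constructor
  · rintro ⟨h, h2⟩
    obtain rfl : y = p := h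
    simp only [Arr.comp, eqToHom_refl, Category.id_comp, Arr.mk.injEq, true_and] at h2
    obtain ⟨rfl, h3⟩ := h2
    have h4 : g ≫ k = g := eq_of_heq h3
    have h5 : k = 𝟙 q := by
      rw [← cancel_epi g, h4, Category.comp_id]
    rw [h5]; rfl
  · intro h
    cases h
    exact ⟨rfl, by simp [Arr.comp]⟩

variable [MeasurableSpace X] [MeasurableSpace (Arr X)]

theorem IsConullUnits.inter {ν : Measure (Arr X)} {U V : Set X} (hU : IsConullUnits ν U)
    (hV : IsConullUnits ν V) : IsConullUnits ν (U ∩ V) :=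
  ⟨hU.1.inter hV.1, by rw [Set.compl_inter]; exact measure_union_null hU.2 hV.2⟩

theorem exists_isConullUnits_of_ae {ν : Measure (Arr X)} {p : X → Prop}
    (h : ∀ᵐ x ∂unitMeasure ν, p x) : ∃ U, IsConullUnits ν U ∧ ∀ x ∈ U, p x := by
  refine ⟨(toMeasurable (unitMeasure ν) {x | ¬p x})ᶜ,
    ⟨(measurableSet_toMeasurable _ _).compl, ?_⟩, fun x hx => ?_⟩
  · rw [compl_compl, measure_toMeasurable]
    exact h
  · by_contra hp
    exact hx (subset_toMeasurable _ _ hp)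

/-- An inessential reduction `G|_U` together with a kernel that charges every element of `G|_U`
over its range, and for which a null set of elements is null over almost every unit. -/
structure IsChargedReduction (ν : Measure (Arr X)) (κ : Kernel X (Arr X)) (U : Set X) : Prop where
  conull : IsConullUnits ν U
  charged : ∀ a ∈ Arr.reduction U, κ a.rng {a} ≠ 0
  null : ∀ N, ν N = 0 → ∀ᵐ x ∂unitMeasure ν, κ x N = 0

theorem IsChargedReduction.mono {ν : Measure (Arr X)} {κ : Kernel X (Arr X)} {U V : Set X}
    (h : IsChargedReduction ν κ U) (hV : IsConullUnits ν V) (hVU : V ⊆ U) :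
    IsChargedReduction ν κ V :=
  ⟨hV, fun a ha => h.charged a ⟨hVU ha.1, hVU ha.2⟩, h.null⟩

/-- A null set over `x` contains no atom, and here every element over `x` is one. Only the range has
to lie in the smaller set `V`. -/
theorem IsChargedReduction.exists_forall_of_ae {ν : Measure (Arr X)} {κ : Kernel X (Arr X)}
    {U : Set X} (h : IsChargedReduction ν κ U) {P : Arr X → Prop} (hP : ∀ᵐ a ∂ν, P a) :
    ∃ V ⊆ U, IsConullUnits ν V ∧ ∀ a : Arr X, a.rng ∈ V → a.src ∈ U → P a := by
  obtain ⟨V, hV, hVx⟩ := exists_isConullUnits_of_ae (h.null _ hP)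
  refine ⟨U ∩ V, Set.inter_subset_left, h.conull.inter hV, fun a ha ha' => ?_⟩
  by_contra hn
  refine h.charged a ⟨ha.1, ha'⟩ (measure_mono_null ?_ (hVx _ ha.2))
  rintro b rfl
  exact hn

variable [IsBorelGroupoid X]

theorem measurable_rng : Measurable (Arr.rng : Arr X → X) := IsBorelGroupoid.measurable_rng

theorem measurable_src : Measurable (Arr.src : Arr X → X) := IsBorelGroupoid.measurable_src

theorem measurableSet_reduction {U : Set X} (hU : MeasurableSet U) :
    MeasurableSet (Arr.reduction U) :=
  (measurable_rng hU).inter (measurable_src hU)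

theorem unitMeasure_apply {ν : Measure (Arr X)} {A : Set X} (hA : MeasurableSet A) :
    unitMeasure ν A = ν (Arr.rng ⁻¹' A) := Measure.map_apply measurable_rng hA

theorem unitMeasure_absolutelyContinuous {ν ν' : Measure (Arr X)} (h : ν ≪ ν') :
    unitMeasure ν ≪ unitMeasure ν' := h.map measurable_rng

/-- The elements of `G|_U` with source in `E`. -/
def sourceIn (U E : Set X) : Set (Arr X) := {a | a ∈ Arr.reduction U ∧ a.src ∈ E}

theorem measurableSet_sourceIn {U E : Set X} (hU : MeasurableSet U) (hE : MeasurableSet E) :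
    MeasurableSet (sourceIn U E) :=
  (measurableSet_reduction hU).inter (measurable_src hE)

theorem IsSymmetricClass.measure_src_preimage_eq_zero_iff {ν : Measure (Arr X)}
    (hν : IsSymmetricClass ν) {A : Set X} (hA : MeasurableSet A) :
    ν (Arr.src ⁻¹' A) = 0 ↔ unitMeasure ν A = 0 := by
  have hi : Measurable (Arr.inverse : Arr X → Arr X) := IsBorelGroupoid.measurable_inverse
  have h1 : (ν.map Arr.inverse) (Arr.rng ⁻¹' A) = ν (Arr.src ⁻¹' A) :=
    Measure.map_apply hi (measurable_rng hA)
  have h2 : unitMeasure ν A = ν (Arr.rng ⁻¹' A) := unitMeasure_apply hA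
  rw [← h1, h2]
  exact ⟨fun h => hν.1 h, fun h => hν.2 h⟩

theorem IsConullUnits.measure_reduction_compl {ν : Measure (Arr X)} {U : Set X}
    (hU : IsConullUnits ν U) (hν : IsSymmetricClass ν) : ν (Arr.reduction U)ᶜ = 0 := by
  have h : (Arr.reduction U)ᶜ = Arr.rng ⁻¹' Uᶜ ∪ Arr.src ⁻¹' Uᶜ := by
    ext a
    simp only [Arr.reduction, Set.mem_compl_iff, Set.mem_ofPred_eq, Set.mem_union,
      Set.mem_preimage]
    tauto
  rw [h]
  refine measure_union_null ?_ ?_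
  · rw [← unitMeasure_apply hU.1.compl, hU.2]
  · rw [hν.measure_src_preimage_eq_zero_iff hU.1.compl, hU.2]

/-- Let `D` be the set of units that are atoms of their own fibre measure. By invariance an element
with source outside `D` is not an atom; since fibres are countable, such elements form a null set,
and by symmetry `D` is conull. Invariance then makes every element with source in `D` an atom. -/
theorem exists_isChargedReduction [StandardBorelSpace X] [StandardBorelSpace (Arr X)]
    {ν : Measure (Arr X)} (hν : IsMeasuredGroupoid ν) (hdisc : IsRDiscrete ν) :
    ∃ κ : Kernel X (Arr X), IsMarkovKernel κ ∧ ∃ U, IsChargedReduction ν κ U := by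
  obtain ⟨ν', hp, h1, h2, κ, hκ, hfib, hbind, U₁, hU₁, hinv⟩ := hν.invariant
  obtain ⟨U₂, hU₂, hcount⟩ := hdisc
  have hunit : Measurable (Arr.unit : X → Arr X) := IsBorelGroupoid.measurable_unit
  have hac : unitMeasure ν ≪ unitMeasure ν' := unitMeasure_absolutelyContinuous h2
  have hnull : ∀ N, ν N = 0 → ∀ᵐ x ∂unitMeasure ν', κ x N = 0 := by
    intro N hN
    have h3 : ν' N = 0 := h1 hN
    rw [← hbind] at h3
    exact Measure.ae_ae_of_ae_bind κ.aemeasurable (measure_eq_zero_iff_ae_notMem.1 h3) |>.mono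
      fun x hx => measure_eq_zero_iff_ae_notMem.2 hx
  let U₀ := U₁ ∩ U₂
  have hU₀ : IsConullUnits ν U₀ := hU₁.inter hU₂
  let D : Set X := {y | κ y {Arr.unit y} ≠ 0}
  have hD : MeasurableSet D := by
    have hset : MeasurableSet {p : X × Arr X | p.2 = Arr.unit p.1} :=
      measurableSet_eq_fun measurable_snd (hunit.comp measurable_fst)
    have := Kernel.measurable_kernel_prodMk_left (κ := κ) hset
    exact (this (measurableSet_singleton 0)).compl
  have hch : ∀ a ∈ Arr.reduction U₁, (κ a.src {Arr.unit a.src} = 0 ↔ κ a.rng {a} = 0) := by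
    intro a ha
    rw [← hinv a ha {a} (measurableSet_singleton a)]
    simp only [Set.mem_singleton_iff, Arr.comp_eq_self_iff]
    rfl
  have hN : ν (Arr.reduction U₀ ∩ Arr.src ⁻¹' Dᶜ) = 0 := by
    have hNm : MeasurableSet (Arr.reduction U₀ ∩ Arr.src ⁻¹' Dᶜ) :=
      (measurableSet_reduction hU₀.1).inter (measurable_src hD.compl)
    refine h2 ?_
    rw [← hbind, Measure.bind_apply hNm κ.aemeasurable,
      lintegral_eq_zero_iff (κ.measurable_coe hNm)]
    filter_upwards [hfib] with x hx
    by_cases hxU : x ∈ U₀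
    · refine measure_mono_null (t := {a | a.rng ≠ x} ∪
        {a | (a.rng = x ∧ a.src ∈ U₂) ∧ κ x {a} = 0}) ?_ (measure_union_null hx ?_)
      · rintro a ⟨ha, haD⟩
        by_cases har : a.rng = x
        · right
          refine ⟨⟨har, ha.2.2⟩, ?_⟩
          rw [← har, ← hch a ⟨ha.1.1, ha.2.1⟩]
          simpa [D] using haD
        · exact Or.inl har
      · have hc : {a : Arr X | (a.rng = x ∧ a.src ∈ U₂) ∧ κ x {a} = 0}.Countable :=
          (hcount x hxU.2).mono fun a ha => ha.1
        rw [← Set.biUnion_of_singleton {a : Arr X | (a.rng = x ∧ a.src ∈ U₂) ∧ κ x {a} = 0}]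
        exact (measure_biUnion_null_iff hc).2 fun a ha => ha.2
    · refine measure_mono_null ?_ hx
      rintro a ⟨ha, -⟩ rfl
      exact hxU ha.1
  have hDc : IsConullUnits ν D := by
    refine ⟨hD, ?_⟩
    rw [← hν.symmetric.measure_src_preimage_eq_zero_iff hD.compl]
    refine measure_mono_null (t := (Arr.reduction U₀ ∩ Arr.src ⁻¹' Dᶜ) ∪ (Arr.reduction U₀)ᶜ) ?_
      (measure_union_null hN (hU₀.measure_reduction_compl hν.symmetric))
    intro a ha
    by_cases h : a ∈ Arr.reduction U₀
    · exact Or.inl ⟨h, ha⟩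
    · exact Or.inr h
  refine ⟨κ, hκ, U₀ ∩ D, hU₀.inter hDc, ?_,
    fun N hN => hac.ae_le (hnull N hN)⟩
  rintro a ⟨ha, ha'⟩
  rw [Ne, ← hch a ⟨ha.1.1, ha'.1.1⟩]
  exact ha'.2

end Groupoid

/-! ### Borel selection and enumeration in the range fibres -/

section Enumeration

variable {X : Type u} [Groupoid.{w} X] [MeasurableSpace X]
  [MeasurableSpace (Arr X)] [StandardBorelSpace (Arr X)] [IsBorelGroupoid X]
  {ν : Measure (Arr X)} {κ : Kernel X (Arr X)} [IsMarkovKernel κ] {U : Set X}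

/-- A Borel subset of a discrete reduction is a countable union of Borel sets on which the range map
is injective. -/
theorem IsChargedReduction.exists_iUnion_injOn (h : IsChargedReduction ν κ U) {A : Set (Arr X)}
    (hA : MeasurableSet A) (hAU : A ⊆ Arr.reduction U) :
    ∃ P : ℕ → Set (Arr X), (∀ n, MeasurableSet (P n)) ∧ (⋃ n, P n) = A ∧
      ∀ n, Set.InjOn Arr.rng (P n) := by
  let f := embeddingReal (Arr X)
  have hf : MeasurableEmbedding f := measurableEmbedding_embeddingReal (Arr X)
  obtain ⟨B, hB⟩ := (TopologicalSpace.countable_countableBasis ℝ).exists_eq_range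
    ((TopologicalSpace.isBasis_countableBasis ℝ).exists_subset_of_mem_open (Set.mem_univ (0 : ℝ))
      isOpen_univ |>.imp fun _ h => h.1)
  have hBo : ∀ n, IsOpen (B n) := fun n =>
    TopologicalSpace.isOpen_of_mem_countableBasis (hB ▸ Set.mem_range_self n)
  have hBm : ∀ n, MeasurableSet (f ⁻¹' B n) := fun n => hf.measurable (hBo n).measurableSet
  have hm : Measurable fun a : Arr X => κ a.rng {a} := by
    have hset : MeasurableSet {p : Arr X × Arr X | p.2 = p.1} :=
      measurableSet_eq_fun measurable_snd measurable_fst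
    exact Kernel.measurable_kernel_prodMk_left (κ := κ.comap Arr.rng measurable_rng) hset
  -- `P n` holds the elements carrying more than half of the fibre mass of the basic set `B n`, so
  -- at most one per fibre. Outer regularity on the line puts every element of `A`, being an atom,
  -- in some `P n`.
  let P : ℕ → Set (Arr X) := fun n =>
    (A ∩ f ⁻¹' B n) ∩ {a | κ a.rng (f ⁻¹' B n) < 2 * κ a.rng {a}}
  refine ⟨P, fun n => (hA.inter (hBm n)).inter (measurableSet_lt
    ((κ.measurable_coe (hBm n)).comp measurable_rng) (hm.const_mul 2)), ?_, fun n => ?_⟩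
  · refine Set.Subset.antisymm (Set.iUnion_subset fun n a ha => ha.1.1) fun a ha => ?_
    have hpos := h.charged a (hAU ha)
    have hlt : (κ a.rng).map f {f a} < 2 * κ a.rng {a} := by
      rw [Measure.map_apply hf.measurable (measurableSet_singleton _),
        ← Set.image_singleton, hf.injective.preimage_image, two_mul]
      exact ENNReal.lt_add_right (measure_ne_top _ _) hpos
    have : IsFiniteMeasure ((κ a.rng).map f) := Measure.isFiniteMeasure_map _ _
    obtain ⟨O, hO, hOo, hOlt⟩ := Set.exists_isOpen_lt_of_lt {f a} _ hlt
    obtain ⟨b, hb, hab, hbO⟩ := (TopologicalSpace.isBasis_countableBasis ℝ).exists_subset_of_mem_open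
      (hO rfl) hOo
    rw [hB] at hb
    obtain ⟨n, rfl⟩ := hb
    refine Set.mem_iUnion.2 ⟨n, ⟨ha, hab⟩, lt_of_le_of_lt ?_ hOlt⟩
    rw [Measure.map_apply hf.measurable hOo.measurableSet]
    exact measure_mono (Set.preimage_mono hbO)
  · rintro a ⟨⟨-, haB⟩, ha⟩ b ⟨⟨-, hbB⟩, hb⟩ hab
    by_contra hne
    simp only [Set.mem_ofPred_eq] at ha hb
    rw [← hab] at hb
    have h1 : κ a.rng {a} + κ a.rng {b} ≤ κ a.rng (f ⁻¹' B n) := by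
      rw [← measure_union (by simpa using hne) (measurableSet_singleton b)]
      refine measure_mono ?_
      rintro c (rfl | rfl)
      · exact haB
      · exact hbB
    have h2 := ENNReal.add_lt_add ha hb
    rw [← mul_add, ← two_mul] at h2
    exact absurd h2 (not_lt.2 (mul_le_mul_right h1 2))

variable [StandardBorelSpace X]

theorem IsChargedReduction.measurableSet_image_rng (h : IsChargedReduction ν κ U) {A : Set (Arr X)}
    (hA : MeasurableSet A) (hAU : A ⊆ Arr.reduction U) : MeasurableSet (Arr.rng '' A) := by
  obtain ⟨P, hP, rfl, hinj⟩ := h.exists_iUnion_injOn hA hAU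
  rw [Set.image_iUnion]
  exact MeasurableSet.iUnion fun n => (hP n).image_of_measurable_injOn measurable_rng (hinj n)

theorem exists_measurable_section {P : Set (Arr X)} (hP : MeasurableSet P)
    (hinj : Set.InjOn Arr.rng P) :
    ∃ g : X → Arr X, Measurable g ∧ (∀ x, (g x).rng = x) ∧ ∀ a ∈ P, g a.rng = a := by
  classical
  have hunit : Measurable (Arr.unit : X → Arr X) := IsBorelGroupoid.measurable_unit
  let g : X → Arr X := fun x => if hx : ∃ a ∈ P, a.rng = x then hx.choose else Arr.unit x
  have hg : ∀ a ∈ P, g a.rng = a := fun a ha => by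
    have hx : ∃ b ∈ P, b.rng = a.rng := ⟨a, ha, rfl⟩
    simp only [g, dif_pos hx]
    exact hinj hx.choose_spec.1 ha hx.choose_spec.2
  have hg' : ∀ x, x ∉ Arr.rng '' P → g x = Arr.unit x := fun x hx => by
    have : ¬∃ a ∈ P, a.rng = x := hx
    simp only [g, dif_neg this]
  refine ⟨g, fun S hS => ?_, fun x => ?_, hg⟩
  · have : g ⁻¹' S = (Arr.rng '' (P ∩ S)) ∪ ((Arr.rng '' P)ᶜ ∩ Arr.unit ⁻¹' S) := by
      ext x
      by_cases hx : x ∈ Arr.rng '' P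
      · simp only [Set.mem_preimage, Set.mem_union, Set.mem_inter_iff, Set.mem_compl_iff, hx,
          not_true, false_and, or_false]
        obtain ⟨a, ha, rfl⟩ := hx
        rw [hg a ha]
        refine ⟨fun h => ⟨a, ⟨ha, h⟩, rfl⟩, ?_⟩
        rintro ⟨b, ⟨hb, hbS⟩, hba⟩
        rwa [← hinj hb ha hba]
      · simp only [Set.mem_preimage, Set.mem_union, Set.mem_inter_iff, Set.mem_compl_iff, hx,
          not_false_iff, true_and, hg' x hx]
        refine ⟨Or.inr, ?_⟩
        rintro (⟨a, ha, rfl⟩ | h)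
        · exact absurd ⟨a, ha.1, rfl⟩ hx
        · exact h
    rw [this]
    exact ((hP.inter hS).image_of_measurable_injOn measurable_rng
      (hinj.mono Set.inter_subset_left)).union
      ((hP.image_of_measurable_injOn measurable_rng hinj).compl.inter (hunit hS))
  · by_cases hx : x ∈ Arr.rng '' P
    · obtain ⟨a, ha, rfl⟩ := hx
      rw [hg a ha]
    · rw [hg' x hx]; rfl

/-- A Borel enumeration of the range fibres of a Borel subset of a discrete reduction. -/
theorem IsChargedReduction.exists_enumeration (h : IsChargedReduction ν κ U) {A : Set (Arr X)}
    (hA : MeasurableSet A) (hAU : A ⊆ Arr.reduction U) :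
    ∃ (y : ℕ → X → X) (g : ∀ n x, x ⟶ y n x),
      (∀ n, Measurable fun x => (⟨x, y n x, g n x⟩ : Arr X)) ∧
      (∀ n, ∀ x ∈ Arr.rng '' A, (⟨x, y n x, g n x⟩ : Arr X) ∈ A) ∧
      ∀ a ∈ A, ∃ n, (⟨a.rng, y n a.rng, g n a.rng⟩ : Arr X) = a := by
  classical
  obtain ⟨P, hP, hPA, hinj⟩ := h.exists_iUnion_injOn hA hAU
  choose s hs hsr hsP using fun n => exists_measurable_section (hP n) (hinj n)
  have hR : ∀ n, MeasurableSet (Arr.rng '' P n) := fun n =>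
    (hP n).image_of_measurable_injOn measurable_rng (hinj n)
  have hRA := h.measurableSet_image_rng hA hAU
  have hex : ∀ x, ∃ n, x ∈ Arr.rng '' P n ∨ x ∉ Arr.rng '' A := by
    intro x
    by_cases hx : x ∈ Arr.rng '' A
    · obtain ⟨a, ha, rfl⟩ := hx
      rw [← hPA] at ha
      obtain ⟨n, hn⟩ := Set.mem_iUnion.1 ha
      exact ⟨n, Or.inl ⟨a, hn, rfl⟩⟩
    · exact ⟨0, Or.inr hx⟩
  -- The first available section fills the gaps, so that over the range image of `A` every term of
  -- the enumeration lies in `A`.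
  let d : X → Arr X := fun x => s (Nat.find (hex x)) x
  have hd : Measurable d := Measurable.find
    (p := fun n x => x ∈ Arr.rng '' P n ∨ x ∉ Arr.rng '' A) hs (fun n => (hR n).union hRA.compl) hex
  let e : ℕ → X → Arr X := fun n x => if x ∈ Arr.rng '' P n then s n x else d x
  have her : ∀ n x, (e n x).rng = x := fun n x => by
    simp only [e, d]
    split_ifs
    · exact hsr _ _
    · exact hsr _ _
  have hsA : ∀ n, ∀ x ∈ Arr.rng '' P n, s n x ∈ A := by
    rintro n _ ⟨a, ha, rfl⟩
    rw [hsP n a ha, ← hPA]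
    exact Set.mem_iUnion.2 ⟨n, ha⟩
  have key : ∀ n x, ∃ (z : X) (k : x ⟶ z), e n x = ⟨x, z, k⟩ := by
    intro n x
    have := her n x
    generalize e n x = a at this
    subst this
    exact ⟨a.src, a.hom, rfl⟩
  choose y g hyg using key
  refine ⟨y, g, fun n => ?_, fun n x hx => ?_, fun a ha => ?_⟩
  · simp only [← hyg]
    exact Measurable.ite (hR n) (hs n) hd
  · rw [← hyg]
    simp only [e]
    split_ifs with hxn
    · exact hsA n x hxn
    · exact hsA _ x ((Nat.find_spec (hex x)).resolve_right fun hn => hn hx)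
  · rw [← hPA] at ha
    obtain ⟨n, hn⟩ := Set.mem_iUnion.1 ha
    refine ⟨n, ?_⟩
    rw [← hyg]
    simp only [e]
    rw [if_pos ⟨a, hn, rfl⟩, hsP n a hn]

end Enumeration

/-! ### Ergodicity -/

section Ergodic

variable {X : Type u} [Groupoid.{w} X] [MeasurableSpace X] [StandardBorelSpace X]
  [MeasurableSpace (Arr X)] [StandardBorelSpace (Arr X)] [IsBorelGroupoid X]

/-- Two Borel sets of units with disjoint saturations are separated by an invariant Borel set. -/
theorem exists_invariant_separator {E T : Set X} (hE : MeasurableSet E) (hT : MeasurableSet T)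
    (hdisj : ∀ a : Arr X, a.rng ∈ E → a.src ∉ T) :
    ∃ A : Set X, MeasurableSet A ∧ (∀ a : Arr X, a.rng ∈ A ↔ a.src ∈ A) ∧ E ⊆ A ∧
      Disjoint A T := by
  obtain ⟨τ, hb, hp⟩ := StandardBorelSpace.polish (α := X)
  have hsat : ∀ B : Set X, MeasurableSet B → AnalyticSet (Arr.src '' (Arr.rng ⁻¹' B)) :=
    fun B hB => (measurable_rng hB).analyticSet_image measurable_src
  -- Saturations are only analytic. Each is enclosed in a Borel set that avoids the saturation of
  -- `T`; iterating, the union becomes invariant.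
  have step : ∀ B : {B : Set X // MeasurableSet B ∧ ∀ a : Arr X, a.rng ∈ B → a.src ∉ T},
      ∃ B' : {B : Set X // MeasurableSet B ∧ ∀ a : Arr X, a.rng ∈ B → a.src ∉ T},
        Arr.src '' (Arr.rng ⁻¹' B.1) ⊆ B'.1 := by
    rintro ⟨B, hB, hBT⟩
    have hd : Disjoint (Arr.src '' (Arr.rng ⁻¹' B)) (Arr.src '' (Arr.rng ⁻¹' T)) := by
      rw [Set.disjoint_left]
      rintro x ⟨⟨p, q, a⟩, ha, rfl⟩ ⟨⟨p', q', b⟩, hb, hab⟩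
      obtain rfl : q' = q := hab
      exact hBT ⟨p, p', a ≫ Groupoid.inv b⟩ ha hb
    obtain ⟨B', h1, h2, h3⟩ := (hsat B hB).measurablySeparable (hsat T hT) hd
    refine ⟨⟨B', h3, fun a ha haT => ?_⟩, h1⟩
    exact Set.disjoint_left.1 h2 ⟨a.inverse, haT, rfl⟩ ha
  choose next hnext using step
  let B : ℕ → {B : Set X // MeasurableSet B ∧ ∀ a : Arr X, a.rng ∈ B → a.src ∉ T} :=
    fun n => Nat.rec ⟨E, hE, hdisj⟩ (fun _ B => next B) n
  have hB : ∀ n (a : Arr X), a.rng ∈ (B n).1 → a.src ∈ (B (n + 1)).1 :=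
    fun n a ha => hnext (B n) ⟨a, ha, rfl⟩
  have hinv : ∀ a : Arr X, a.rng ∈ ⋃ n, (B n).1 → a.src ∈ ⋃ n, (B n).1 := by
    intro a ha
    obtain ⟨n, hn⟩ := Set.mem_iUnion.1 ha
    exact Set.mem_iUnion.2 ⟨n + 1, hB n a hn⟩
  refine ⟨⋃ n, (B n).1, MeasurableSet.iUnion fun n => (B n).2.1,
    fun a => ⟨hinv a, hinv a.inverse⟩, Set.subset_iUnion (fun n => (B n).1) 0, ?_⟩
  rw [Set.disjoint_left]
  intro x hx hxT
  obtain ⟨n, hn⟩ := Set.mem_iUnion.1 hx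
  exact (B n).2.2 (Arr.unit x) hn hxT

/-- The saturation inside `G|_U` need not be invariant under all of `G`, so ergodicity is applied to
an invariant Borel set separating `E` from the rest of `U`. -/
theorem IsErgodic.isConullUnits_saturation {ν : Measure (Arr X)} (herg : IsErgodic ν)
    {κ : Kernel X (Arr X)} [IsMarkovKernel κ] {U E : Set X} (h : IsChargedReduction ν κ U)
    (hE : MeasurableSet E) (hEU : E ⊆ U) (hpos : 0 < unitMeasure ν E) :
    IsConullUnits ν (Arr.rng '' sourceIn U E) := by
  have hS : MeasurableSet (Arr.rng '' sourceIn U E) :=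
    h.measurableSet_image_rng (measurableSet_sourceIn h.conull.1 hE) fun a ha => ha.1
  refine ⟨hS, ?_⟩
  obtain ⟨A, hA, hinv, hEA, hd⟩ := exists_invariant_separator hE (h.conull.1.diff hS) (by
    intro a ha haT
    exact haT.2 ⟨a.inverse, ⟨⟨haT.1, hEU ha⟩, ha⟩, rfl⟩)
  have hAc : unitMeasure ν Aᶜ = 0 := (herg A hA hinv).resolve_left fun h0 =>
    hpos.ne' (measure_mono_null hEA h0)
  refine measure_mono_null (t := Aᶜ ∪ Uᶜ) (fun x hx => ?_) (measure_union_null hAc h.conull.2)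
  by_cases hxU : x ∈ U
  · exact Or.inl fun hxA => Set.disjoint_left.1 hd hxA ⟨hxU, hx⟩
  · exact Or.inr hxU

end Ergodic


/-! ### From fibrewise to uniform bounds -/

section Boundedness

variable {X : Type u} [Groupoid.{w} X] [MeasurableSpace X] [StandardBorelSpace X]
  [MeasurableSpace (Arr X)] [StandardBorelSpace (Arr X)] [IsBorelGroupoid X]
  {ν : Measure (Arr X)}

/-- A Borel function that is bounded on the fibres of a reduction is bounded on a smaller
reduction. -/
theorem exists_bounded_of_fibrewise_bounded {κ : Kernel X (Arr X)} [IsMarkovKernel κ] {U : Set X}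
    (h : IsChargedReduction ν κ U) {ψ : Arr X → ℝ} (hψ : Measurable ψ) {E : Set X}
    (hE : MeasurableSet E) (hpos : 0 < unitMeasure ν E)
    (hbdd : ∀ x ∈ E, BddAbove {t : ℝ | ∃ γ : Arr X, γ.rng = x ∧ γ.src ∈ E ∧ t = |ψ γ|}) :
    ∃ E : Set X, MeasurableSet E ∧ 0 < unitMeasure ν E ∧
      ∃ M : ℝ, ∀ γ ∈ Arr.reduction E, |ψ γ| ≤ M := by
  have hEU : MeasurableSet (E ∩ U) := hE.inter h.conull.1
  let B : ℕ → Set (Arr X) := fun n => Arr.reduction (E ∩ U) ∩ {a | (n : ℝ) < |ψ a|}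
  have hB : ∀ n, MeasurableSet (B n) := fun n =>
    (measurableSet_reduction hEU).inter (measurableSet_lt measurable_const hψ.abs)
  -- The units over which `|ψ| ≤ n` on elements with source in `E ∩ U`; Borel because range images
  -- are.
  let F : ℕ → Set X := fun n => (E ∩ U) \ Arr.rng '' B n
  have hF : ∀ n, MeasurableSet (F n) := fun n =>
    hEU.diff (h.measurableSet_image_rng (hB n) fun a ha => ⟨ha.1.1.2, ha.1.2.2⟩)
  have hcover : E ⊆ (⋃ n, F n) ∪ Uᶜ := by
    intro x hx
    by_cases hxU : x ∈ U
    · obtain ⟨M, hM⟩ := hbdd x hx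
      obtain ⟨n, hn⟩ := exists_nat_ge M
      refine Or.inl (Set.mem_iUnion.2 ⟨n, ⟨hx, hxU⟩, ?_⟩)
      rintro ⟨a, ⟨ha, han⟩, rfl⟩
      have h1 : (n : ℝ) < |ψ a| := han
      exact absurd (hM ⟨a, rfl, ha.2.1, rfl⟩) (not_le.2 (hn.trans_lt h1))
    · exact Or.inr hxU
  have hn : ∃ n, 0 < unitMeasure ν (F n) := by
    by_contra! hcon
    refine hpos.ne' (measure_mono_null hcover (measure_union_null ?_ h.conull.2))
    exact measure_iUnion_null fun n => le_antisymm (hcon n) bot_le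
  obtain ⟨n, hn⟩ := hn
  refine ⟨F n, hF n, hn, n, fun a ha => ?_⟩
  by_contra! hlt
  exact ha.1.2 ⟨a, ⟨⟨ha.1.1, ha.2.1⟩, hlt⟩, rfl⟩

end Boundedness

/-! ### Unitarity on reductions and coboundaries -/

section Unitary

variable {X : Type u} [Groupoid.{w} X] [MeasurableSpace X] [MeasurableSpace (Arr X)]
  {ν : Measure (Arr X)} {H : HilbertBundle.{u, v} X}

/-- The operators `L(γ)`, `γ ∈ G|_U`, form a unitary representation of `G|_U`. -/
structure Representation.IsUnitaryOn (L : Representation ν H) (U : Set X) : Prop where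
  isometry : ∀ {x y : X}, x ∈ U → y ∈ U → ∀ γ : x ⟶ y, Isometry (L.op γ)
  surjective : ∀ {x y : X}, x ∈ U → y ∈ U → ∀ γ : x ⟶ y, Function.Surjective (L.op γ)
  op_comp : ∀ {x y z : X}, x ∈ U → y ∈ U → z ∈ U → ∀ (γ₁ : x ⟶ y) (γ₂ : y ⟶ z),
    L.op (γ₁ ≫ γ₂) = (L.op γ₁).comp (L.op γ₂)

variable {L : Representation ν H} {U : Set X}

theorem Representation.op_apply_eq_of_mk_eq (L : Representation ν H) {x y z : X} {g : x ⟶ y}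
    {k : x ⟶ z} (h : (⟨x, y, g⟩ : Arr X) = ⟨x, z, k⟩) (ξ : ∀ x, H.fiber x) :
    L.op g (ξ y) = L.op k (ξ z) := by
  cases h; rfl

theorem Representation.exists_isUnitaryOn (L : Representation ν H) :
    ∃ U, IsConullUnits ν U ∧ L.IsUnitaryOn U := by
  obtain ⟨U, hU, h1, h2⟩ := L.exists_reduction
  exact ⟨U, hU, fun hx hy γ => (h1 _ hx _ hy γ).1, fun hx hy γ => (h1 _ hx _ hy γ).2,
    fun hx hy hz => h2 _ hx _ hy _ hz⟩

namespace Representation.IsUnitaryOn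

theorem mono (h : L.IsUnitaryOn U) {V : Set X} (hV : V ⊆ U) : L.IsUnitaryOn V :=
  ⟨fun hx hy => h.isometry (hV hx) (hV hy), fun hx hy => h.surjective (hV hx) (hV hy),
    fun hx hy hz => h.op_comp (hV hx) (hV hy) (hV hz)⟩

theorem norm_op (h : L.IsUnitaryOn U) {x y : X} (hx : x ∈ U) (hy : y ∈ U) (γ : x ⟶ y)
    (v : H.fiber y) : ‖L.op γ v‖ = ‖v‖ :=
  (h.isometry hx hy γ).norm_map_of_map_zero (map_zero _) v

theorem op_comp_apply (h : L.IsUnitaryOn U) {x y z : X} (hx : x ∈ U) (hy : y ∈ U) (hz : z ∈ U)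
    (γ₁ : x ⟶ y) (γ₂ : y ⟶ z) (v : H.fiber z) : L.op (γ₁ ≫ γ₂) v = L.op γ₁ (L.op γ₂ v) := by
  rw [h.op_comp hx hy hz]; rfl

theorem op_id (h : L.IsUnitaryOn U) {x : X} (hx : x ∈ U) (v : H.fiber x) : L.op (𝟙 x) v = v := by
  apply (h.isometry hx hx (𝟙 x)).injective
  rw [← h.op_comp_apply hx hx hx, Category.comp_id]

/-- Writes the coboundary at `γ⁻¹δ` as a distance between two vectors in the fibre over `x`; hence
its squared norm is conditionally negative definite. -/
theorem norm_cobdry (h : L.IsUnitaryOn U) {x y z : X} (hx : x ∈ U) (hy : y ∈ U) (hz : z ∈ U)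
    (γ : x ⟶ y) (δ : x ⟶ z) (ξ : ∀ x, H.fiber x) :
    ‖L.cobdry ξ ⟨y, z, Groupoid.inv γ ≫ δ⟩‖ = ‖L.op γ (ξ y) - L.op δ (ξ z)‖ := by
  rw [← h.norm_op hx hy γ, Representation.cobdry, map_sub, ← h.op_comp_apply hx hy hz]
  simp

theorem norm_cobdry_inverse (h : L.IsUnitaryOn U) {a : Arr X} (ha : a ∈ Arr.reduction U)
    (ξ : ∀ x, H.fiber x) : ‖L.cobdry ξ a.inverse‖ = ‖L.cobdry ξ a‖ := by
  have h1 := h.norm_cobdry ha.1 ha.2 ha.1 a.hom (𝟙 a.rng) ξ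
  rw [Category.comp_id, h.op_id ha.1, norm_sub_rev] at h1
  exact h1

theorem cobdry_unit (h : L.IsUnitaryOn U) {x : X} (hx : x ∈ U) (ξ : ∀ x, H.fiber x) :
    L.cobdry ξ (Arr.unit x) = 0 :=
  sub_eq_zero.2 (h.op_id hx (ξ x)).symm

end Representation.IsUnitaryOn

/-- The conditionally negative definite function of a sequence of sections. -/
noncomputable def sumCobdry (L : Representation ν H) (ξ : ℕ → ∀ x, H.fiber x) (a : Arr X) :
    ENNReal :=
  ∑' k, ENNReal.ofReal (2 ^ k * ‖L.cobdry (ξ k) a‖ ^ 2)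

theorem hasSum_sumCobdry {ξ : ℕ → ∀ x, H.fiber x} {a : Arr X} (h : sumCobdry L ξ a < ⊤) :
    HasSum (fun k => 2 ^ k * ‖L.cobdry (ξ k) a‖ ^ 2) (sumCobdry L ξ a).toReal := by
  have h1 := ENNReal.hasSum_toReal h.ne
  have h2 : ∀ k, (ENNReal.ofReal (2 ^ k * ‖L.cobdry (ξ k) a‖ ^ 2)).toReal =
      2 ^ k * ‖L.cobdry (ξ k) a‖ ^ 2 := fun k => ENNReal.toReal_ofReal (by positivity)
  rw [← ENNReal.tsum_toReal_eq (fun k => ENNReal.ofReal_ne_top)] at h1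
  simpa only [h2, sumCobdry] using h1

/-- For weights of sum zero the left side is `-2‖∑ c_i p_i‖²`. -/
theorem sum_mul_norm_sub_sq_nonpos {E : Type*} [NormedAddCommGroup E] [InnerProductSpace ℂ E]
    {n : ℕ} (p : Fin n → E) (c : Fin n → ℝ) (hc : ∑ i, c i = 0) :
    ∑ i, ∑ j, c i * c j * ‖p i - p j‖ ^ 2 ≤ 0 := by
  let _ : InnerProductSpace ℝ E := InnerProductSpace.rclikeToReal ℂ E
  have h := inner_sum_smul_sum_smul_of_sum_eq_zero (s₁ := Finset.univ) (s₂ := Finset.univ) p hc p hc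
  have h2 : 0 ≤ inner ℝ (∑ i, c i • p i) (∑ i, c i • p i) := real_inner_self_nonneg
  rw [h] at h2
  simp only [← sq] at h2
  linarith

end Unitary

/-! ### Borel dependence of minimal points -/

section MinPoint

variable {X : Type u} [MeasurableSpace X] [StandardBorelSpace X] {H : HilbertBundle.{u, v} X}

theorem HilbertBundle.isBorelSection_midSeq {p : ℕ → ∀ x, H.fiber x}
    (hp : ∀ n, H.IsBorelSection (p n)) (i : ℕ) :
    H.IsBorelSection fun x => midSeq (fun n => p n x) i := by
  have key : ∀ k i, H.IsBorelSection fun x => midHull (fun n => p n x) k i := by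
    intro k
    induction k with
    | zero => exact hp
    | succ k ih =>
      intro i
      exact HilbertBundle.measurable_smul (f := id) measurable_id
        (HilbertBundle.measurable_add (f := id) measurable_id (ih _) (ih _)) measurable_const
  exact key _ _

/-- The minimal point is the limit of the first hull members whose norms are within `1/(k+1)` of the
infimum, a Borel choice. -/
theorem HilbertBundle.isBorelSection_of_isMinPoint {p : ℕ → ∀ x, H.fiber x}
    (hp : ∀ n, H.IsBorelSection (p n)) {z : ∀ x, H.fiber x}
    (hz : ∀ x, IsMinPoint (fun n => p n x) (z x)) : H.IsBorelSection z := by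
  classical
  have hw := isBorelSection_midSeq hp
  have hnorm : ∀ i, Measurable fun x => ‖midSeq (fun n => p n x) i‖ := fun i =>
    HilbertBundle.measurable_norm (f := id) measurable_id (hw i)
  have hinf : Measurable fun x => infNorm (midSeq fun n => p n x) := Measurable.iInf hnorm
  have hex := fun (k : ℕ) (x : X) => exists_norm_lt_infNorm_add (midSeq fun n => p n x) k
  have hfind : ∀ k, Measurable fun x => Nat.find (hex k x) := fun k =>
    measurable_find (hex k) fun i => measurableSet_lt (hnorm i) (hinf.add_const _)
  refine HilbertBundle.measurable_of_tendsto (f := id) measurable_id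
    (U := fun k x => midSeq (fun n => p n x) (Nat.find (hex k x)))
    (fun k => HilbertBundle.measurable_select (f := id) measurable_id hw (hfind k)) fun x => ?_
  exact hz x _ (tendsto_norm_infNorm fun k => Nat.find_spec (hex k x))

end MinPoint

/-! ### Invariant sections from minimal points -/

section InvariantSection

variable {X : Type u} [Groupoid.{w} X] [MeasurableSpace X] [StandardBorelSpace X]
  [MeasurableSpace (Arr X)] [IsBorelGroupoid X] {H : HilbertBundle.{u, v} X}

variable [StandardBorelSpace (Arr X)] {ν : Measure (Arr X)} {L : Representation ν H}

/-- A unit section that is moved by at most `1/2` on `G|_E` yields an invariant unit section. -/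
theorem Representation.hasUnitInvariantSection_of_norm_cobdry_le (hsymm : IsSymmetricClass ν)
    (herg : IsErgodic ν) {κ : Kernel X (Arr X)} [IsMarkovKernel κ] {U : Set X}
    (h : IsChargedReduction ν κ U) (hL : L.IsUnitaryOn U) {ξ : ∀ x, H.fiber x}
    (hξ : H.IsBorelSection ξ) (hξU : ∀ x ∈ U, ‖ξ x‖ = 1) {E : Set X} (hE : MeasurableSet E)
    (hEU : E ⊆ U) (hpos : 0 < unitMeasure ν E)
    (hsmall : ∀ a ∈ Arr.reduction E, ‖L.cobdry ξ a‖ ≤ 1 / 2) : L.HasUnitInvariantSection := by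
  classical
  let A := sourceIn U E
  have hA : MeasurableSet A := measurableSet_sourceIn h.conull.1 hE
  have hAU : A ⊆ Arr.reduction U := fun a ha => ha.1
  let S := Arr.rng '' A
  have hS : IsConullUnits ν S := herg.isConullUnits_saturation h hE hEU hpos
  have hSU : S ⊆ U := by
    rintro _ ⟨a, ha, rfl⟩
    exact ha.1.1
  obtain ⟨y, g, hg, hgA, hgsurj⟩ := h.exists_enumeration hA hAU
  -- The translates to `x` of `ξ` along the elements over `x` with source in `E`. They are unit
  -- vectors at mutual distance at most `1/2`.
  let p : ℕ → ∀ x, H.fiber x := fun n x => L.op (g n x) (ξ (y n x))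
  have hp : ∀ n, H.IsBorelSection (p n) := fun n => (L.measurable_op_section hξ).comp (hg n)
  choose z hz using fun x => exists_isMinPoint fun n => p n x
  have hzB : H.IsBorelSection z := HilbertBundle.isBorelSection_of_isMinPoint hp hz
  have hyE : ∀ n, ∀ x ∈ S, y n x ∈ E := fun n x hx => (hgA n x hx).2
  have hz0 : ∀ x ∈ S, z x ≠ 0 := by
    intro x hx h0
    have h1 : ∀ n, ‖p n x - p 0 x‖ ≤ 1 / 2 := fun n => by
      rw [← hL.norm_cobdry (hSU hx) (hEU (hyE n x hx)) (hEU (hyE 0 x hx))]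
      exact hsmall _ ⟨hyE n x hx, hyE 0 x hx⟩
    have h2 := (hz x).norm_sub_le h1
    have h3 : ‖p 0 x‖ = 1 := by
      rw [hL.norm_op (hSU hx) (hEU (hyE 0 x hx)), hξU _ (hEU (hyE 0 x hx))]
    rw [h0, zero_sub, norm_neg, h3] at h2
    norm_num at h2
  -- Left multiplication by `γ` maps the elements over `x'` with source in `E` to those over `x`.
  have hmove : ∀ {x x' : X} (hx : x ∈ S) (hx' : x' ∈ S) (γ : x ⟶ x') (i : ℕ),
      ∃ j, L.op γ (p i x') = p j x := by
    intro x x' hx hx' γ i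
    obtain ⟨n, hn⟩ := hgsurj ⟨x, y i x', γ ≫ g i x'⟩
      ⟨⟨hSU hx, hEU (hyE i x' hx')⟩, hyE i x' hx'⟩
    refine ⟨n, ?_⟩
    simp only [p]
    rw [← hL.op_comp_apply (hSU hx) (hSU hx') (hEU (hyE i x' hx'))]
    exact (L.op_apply_eq_of_mk_eq hn ξ).symm
  have hinv : ∀ a ∈ Arr.reduction S, L.op a.hom (z a.src) = z a.rng := by
    rintro ⟨x, x', γ⟩ ⟨hx, hx'⟩
    exact IsMinPoint.map (hL.isometry (hSU hx) (hSU hx') γ)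
      (hL.isometry (hSU hx') (hSU hx) (Groupoid.inv γ)) (hmove hx hx' γ)
      (hmove hx' hx (Groupoid.inv γ)) (hz x') (hz x)
  refine ⟨fun x => ((‖z x‖⁻¹ : ℝ) : ℂ) • z x, ⟨?_, ?_⟩, ?_⟩
  · exact HilbertBundle.measurable_smul (f := id) measurable_id hzB
      (Complex.measurable_ofReal.comp
        (HilbertBundle.measurable_norm (f := id) measurable_id hzB).inv)
  · refine measure_mono_null (fun x hx => ?_) hS.2
    intro hxS
    apply hx
    have := norm_ne_zero_iff.2 (hz0 x hxS)
    simp only [Set.mem_ofPred_eq, norm_smul, Complex.norm_real, norm_inv, norm_norm]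
    exact inv_mul_cancel₀ this
  · refine measure_mono_null (fun a ha => ?_) (hS.measure_reduction_compl hsymm)
    intro haS
    apply ha
    simp only [Set.mem_ofPred_eq, Representation.cobdry, map_smul, hinv a haS]
    rw [← hinv a haS, hL.norm_op (hSU haS.1) (hSU haS.2), sub_self]

end InvariantSection

/-! ### From almost invariant sections to property T -/

section AlmostInvariant

variable {X : Type u} [Groupoid.{w} X] [MeasurableSpace X] [StandardBorelSpace X]
  [MeasurableSpace (Arr X)] [IsBorelGroupoid X] {H : HilbertBundle.{u, v} X}
  {ν : Measure (Arr X)} {L : Representation ν H}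

theorem tendsto_lintegral_norm_cobdry_sq [IsProbabilityMeasure ν] (hsymm : IsSymmetricClass ν)
    {U : Set X} (hU : IsConullUnits ν U) (hL : L.IsUnitaryOn U) {ξ : ℕ → ∀ x, H.fiber x}
    (hξ : ∀ n, H.IsBorelSection (ξ n)) (hξU : ∀ x ∈ U, ∀ n, ‖ξ n x‖ = 1)
    (hlim : ∀ᵐ a ∂ν, Tendsto (fun n => L.cobdry (ξ n) a) atTop (𝓝 0)) :
    Tendsto (fun n => ∫⁻ a, ENNReal.ofReal (‖L.cobdry (ξ n) a‖ ^ 2) ∂ν) atTop (𝓝 0) := by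
  have hU' : ∀ᵐ a ∂ν, a ∈ Arr.reduction U := hU.measure_reduction_compl hsymm
  have h := tendsto_lintegral_of_dominated_convergence (μ := ν)
    (F := fun n a => ENNReal.ofReal (‖L.cobdry (ξ n) a‖ ^ 2)) (f := fun _ => 0)
    (fun _ => ENNReal.ofReal 4)
    (fun n => ((L.measurable_norm_cobdry (hξ n)).pow_const 2).ennreal_ofReal) (fun n => ?_)
    (by simp) ?_
  · simpa using h
  · filter_upwards [hU'] with a ha
    refine ENNReal.ofReal_le_ofReal ?_
    have h1 : ‖L.cobdry (ξ n) a‖ ≤ 2 := by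
      refine (norm_sub_le _ _).trans ?_
      rw [hL.norm_op ha.1 ha.2, hξU _ ha.1, hξU _ ha.2]
      norm_num
    nlinarith [norm_nonneg (L.cobdry (ξ n) a)]
  · filter_upwards [hlim] with a ha
    have h1 := ENNReal.tendsto_ofReal (ha.norm.pow 2)
    simpa using h1

theorem measurable_sumCobdry {ξ : ℕ → ∀ x, H.fiber x} (hξ : ∀ n, H.IsBorelSection (ξ n)) :
    Measurable (sumCobdry L ξ) :=
  Measurable.tsum fun k =>
    (((L.measurable_norm_cobdry (hξ k)).pow_const 2).const_mul _).ennreal_ofReal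

theorem exists_subseq_sumCobdry_lt_top {ξ : ℕ → ∀ x, H.fiber x} (hξ : ∀ n, H.IsBorelSection (ξ n))
    (hlim : Tendsto (fun n => ∫⁻ a, ENNReal.ofReal (‖L.cobdry (ξ n) a‖ ^ 2) ∂ν) atTop (𝓝 0)) :
    ∃ u : ℕ → ℕ, ∀ᵐ a ∂ν, sumCobdry L (fun k => ξ (u k)) a < ⊤ := by
  -- With integrals below `4^{-k}`, the weights `2^k` leave terms below `2^{-k}`, which are
  -- summable.
  have h1 : ∀ k : ℕ, ∃ n, ∫⁻ a, ENNReal.ofReal (‖L.cobdry (ξ n) a‖ ^ 2) ∂ν <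
      ENNReal.ofReal ((1 / 4) ^ k) := fun k =>
    (hlim.eventually_lt_const (ENNReal.ofReal_pos.2 (by positivity))).exists
  choose u hu using h1
  refine ⟨u, ae_lt_top (measurable_sumCobdry fun k => hξ (u k)) ?_⟩
  have hm : ∀ k, Measurable fun a => ENNReal.ofReal (‖L.cobdry (ξ (u k)) a‖ ^ 2) := fun k =>
    ((L.measurable_norm_cobdry (hξ (u k))).pow_const 2).ennreal_ofReal
  simp only [sumCobdry]
  rw [lintegral_tsum fun k => (((L.measurable_norm_cobdry (hξ (u k))).pow_const
    2).const_mul _).ennreal_ofReal.aemeasurable]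
  have h2 : ∀ k, ∫⁻ a, ENNReal.ofReal (2 ^ k * ‖L.cobdry (ξ (u k)) a‖ ^ 2) ∂ν ≤
      ENNReal.ofReal ((1 / 2) ^ k) := by
    intro k
    simp only [ENNReal.ofReal_mul (show (0 : ℝ) ≤ 2 ^ k by positivity)]
    rw [lintegral_const_mul _ (hm k)]
    calc _ ≤ ENNReal.ofReal (2 ^ k) * ENNReal.ofReal ((1 / 4) ^ k) := by gcongr; exact (hu k).le
      _ = _ := by
        rw [← ENNReal.ofReal_mul (by positivity), ← mul_pow]
        norm_num
  refine ne_top_of_le_ne_top ?_ (ENNReal.tsum_le_tsum h2)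
  rw [← ENNReal.ofReal_tsum_of_nonneg (fun k => by positivity) summable_geometric_two]
  exact ENNReal.ofReal_ne_top

theorem isCondNegDef_sumCobdry {U : Set X} (hU : IsConullUnits ν U) (hL : L.IsUnitaryOn U)
    {ξ : ℕ → ∀ x, H.fiber x} (hξ : ∀ n, H.IsBorelSection (ξ n))
    (hfin : ∀ a ∈ Arr.reduction U, sumCobdry L ξ a < ⊤) :
    IsCondNegDef ν fun a => (sumCobdry L ξ a).toReal := by
  refine ⟨(measurable_sumCobdry hξ).ennreal_toReal, U, hU, fun x hx => ?_, fun a ha => ?_,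
    fun x hx n _ y hy γ c hc => ?_⟩
  · simp [sumCobdry, hL.cobdry_unit hx]
  · simp only [sumCobdry, hL.norm_cobdry_inverse ha]
  · have h1 := hasSum_sum fun i (_ : i ∈ Finset.univ) => hasSum_sum
      fun j (_ : j ∈ Finset.univ) => (hasSum_sumCobdry
        (hfin ⟨y i, y j, Groupoid.inv (γ i) ≫ γ j⟩ ⟨hy i, hy j⟩)).mul_left (c i * c j)
    refine hasSum_le (fun k => ?_) h1 hasSum_zero
    simp only [hL.norm_cobdry hx (hy _) (hy _)]
    have h2 := sum_mul_norm_sub_sq_nonpos (fun i => L.op (γ i) (ξ k (y i))) c hc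
    have h3 := mul_nonpos_of_nonneg_of_nonpos (show (0 : ℝ) ≤ 2 ^ k by positivity) h2
    refine le_of_eq_of_le ?_ h3
    simp only [Finset.mul_sum]
    refine Finset.sum_congr rfl fun i _ => Finset.sum_congr rfl fun j _ => ?_
    ring

theorem propertyT_of_bounded [StandardBorelSpace (Arr X)] [IsProbabilityMeasure ν]
    (hν : IsMeasuredGroupoid ν) (herg : IsErgodic ν) (hdisc : IsRDiscrete ν)
    (hb : ∀ ψ : Arr X → ℝ, IsCondNegDef ν ψ →
      ∃ E : Set X, MeasurableSet E ∧ 0 < unitMeasure ν E ∧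
        ∃ M : ℝ, ∀ γ ∈ Arr.reduction E, |ψ γ| ≤ M) : PropertyT.{u, v, w} ν := by
  rintro H L ⟨ξ, hξ, hlim⟩
  obtain ⟨κ, hκ, U₀, hU₀⟩ := exists_isChargedReduction hν hdisc
  obtain ⟨U₁, hU₁, hL₁⟩ := L.exists_isUnitaryOn
  obtain ⟨U₂, hU₂, hξ₂⟩ := exists_isConullUnits_of_ae (ae_all_iff.2 fun n => (hξ n).2)
  let U := (U₀ ∩ U₁) ∩ U₂
  have hU : IsConullUnits ν U := (hU₀.conull.inter hU₁).inter hU₂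
  have hch := hU₀.mono hU fun x hx => hx.1.1
  have hL : L.IsUnitaryOn U := hL₁.mono fun x hx => hx.1.2
  have hξU : ∀ x ∈ U, ∀ n, ‖ξ n x‖ = 1 := fun x hx => hξ₂ x hx.2
  have hξB : ∀ n, H.IsBorelSection (ξ n) := fun n => (hξ n).1
  obtain ⟨u, hu⟩ := exists_subseq_sumCobdry_lt_top hξB
    (tendsto_lintegral_norm_cobdry_sq hν.symmetric hU hL hξB hξU hlim)
  obtain ⟨V, hVU, hV, hfin⟩ := hch.exists_forall_of_ae hu
  have hfinV : ∀ a ∈ Arr.reduction V, sumCobdry L (fun k => ξ (u k)) a < ⊤ := fun a ha =>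
    hfin a ha.1 (hVU ha.2)
  obtain ⟨E, hE, hpos, M, hM⟩ := hb _
    (isCondNegDef_sumCobdry hV (hL.mono hVU) (fun k => hξB (u k)) hfinV)
  -- If `2^k > 4M`, then `2^k ‖c(ξ)‖² ≤ M` forces `‖c(ξ)‖ ≤ 1/2`.
  obtain ⟨k, hk⟩ := pow_unbounded_of_one_lt (4 * M) (one_lt_two (α := ℝ))
  have hposV : 0 < unitMeasure ν (E ∩ V) := by
    rw [pos_iff_ne_zero]
    intro h0
    refine hpos.ne' (measure_mono_null (t := (E ∩ V) ∪ Vᶜ) (fun x hx => ?_)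
      (measure_union_null h0 hV.2))
    by_cases hxV : x ∈ V
    · exact Or.inl ⟨hx, hxV⟩
    · exact Or.inr hxV
  refine Representation.hasUnitInvariantSection_of_norm_cobdry_le hν.symmetric herg hch hL
    (hξB (u k)) (fun x hx => hξU x hx _) (hE.inter hV.1) (fun x hx => hVU hx.2) hposV ?_
  intro a ha
  have h1 := hasSum_sumCobdry (hfinV a ⟨ha.1.2, ha.2.2⟩)
  have h2 := le_hasSum h1 k fun j _ => by positivity
  have h3 := (le_abs_self _).trans (hM a ⟨ha.1.1, ha.2.1⟩)
  have h4 : (2 : ℝ) ^ k * ‖L.cobdry (ξ (u k)) a‖ ^ 2 ≤ 2 ^ k * (1 / 2) ^ 2 := by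
    refine (h2.trans h3).trans ?_
    linarith
  exact (sq_le_sq₀ (norm_nonneg _) (by norm_num)).1
    (le_of_mul_le_mul_left h4 (by positivity))

end AlmostInvariant


/-! ### Inequalities for conditionally negative definite functions -/

section CondNegDef

variable {X : Type u} [Groupoid.{w} X]

/-- `ψ` is conditionally negative definite on `G|_U`. -/
structure IsCondNegDefOn (U : Set X) (ψ : Arr X → ℝ) : Prop where
  unit : ∀ x ∈ U, ψ (Arr.unit x) = 0
  inverse : ∀ γ ∈ Arr.reduction U, ψ γ.inverse = ψ γ
  sum_nonpos : ∀ x ∈ U, ∀ n : ℕ, 2 ≤ n → ∀ y : Fin n → X, (∀ i, y i ∈ U) → ∀ γ : ∀ i, x ⟶ y i,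
    ∀ c : Fin n → ℝ, ∑ i, c i = 0 →
      ∑ i, ∑ j, c i * c j * ψ ⟨y i, y j, Groupoid.inv (γ i) ≫ γ j⟩ ≤ 0

variable {U : Set X} {ψ : Arr X → ℝ}

theorem IsCondNegDefOn.mono (h : IsCondNegDefOn U ψ) {V : Set X} (hV : V ⊆ U) :
    IsCondNegDefOn V ψ :=
  ⟨fun x hx => h.unit x (hV hx), fun a ha => h.inverse a ⟨hV ha.1, hV ha.2⟩,
    fun x hx n hn y hy => h.sum_nonpos x (hV hx) n hn y fun i => hV (hy i)⟩

namespace IsCondNegDefOn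

theorem apply_inv_comp_self (h : IsCondNegDefOn U ψ) {x z : X} (hz : z ∈ U) (γ : x ⟶ z) :
    ψ ⟨z, z, Groupoid.inv γ ≫ γ⟩ = 0 := by
  rw [Groupoid.inv_comp]
  exact h.unit z hz

theorem apply_inv_comp_comm (h : IsCondNegDefOn U ψ) {x z z' : X} (hz : z ∈ U) (hz' : z' ∈ U)
    (γ : x ⟶ z) (δ : x ⟶ z') :
    ψ ⟨z, z', Groupoid.inv γ ≫ δ⟩ = ψ ⟨z', z, Groupoid.inv δ ≫ γ⟩ := by
  rw [← h.inverse ⟨z, z', Groupoid.inv γ ≫ δ⟩ ⟨hz, hz'⟩]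
  simp only [Arr.inverse, Groupoid.inv_eq_inv, IsIso.inv_comp, IsIso.inv_inv]

theorem nonneg (h : IsCondNegDefOn U ψ) {x z : X} (hx : x ∈ U) (hz : z ∈ U) (γ : x ⟶ z) :
    0 ≤ ψ ⟨x, z, γ⟩ := by
  let p : Fin 2 → Σ z, x ⟶ z := ![⟨x, 𝟙 x⟩, ⟨z, γ⟩]
  have h1 := h.sum_nonpos x hx 2 le_rfl (fun i => (p i).1)
    (fun i => by fin_cases i <;> assumption) (fun i => (p i).2) ![1, -1] (by simp)
  have e1 := h.apply_inv_comp_self hx (𝟙 x)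
  have e2 := h.apply_inv_comp_self hz γ
  have e3 := h.apply_inv_comp_comm hz hx γ (𝟙 x)
  have e4 : (⟨x, z, Groupoid.inv (𝟙 x) ≫ γ⟩ : Arr X) = ⟨x, z, γ⟩ := by simp
  simp only [Fin.sum_univ_two, p, Matrix.cons_val_zero, Matrix.cons_val_one] at h1
  rw [e1, e2, e3, e4] at h1
  linarith

/-- A quasi-triangle inequality. -/
theorem apply_le (h : IsCondNegDefOn U ψ) {x z z' : X} (hx : x ∈ U) (hz : z ∈ U) (hz' : z' ∈ U)
    (γ : x ⟶ z) (δ : x ⟶ z') :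
    ψ ⟨x, z, γ⟩ ≤ 2 * ψ ⟨x, z', δ⟩ + 2 * ψ ⟨z, z', Groupoid.inv γ ≫ δ⟩ := by
  let p : Fin 3 → Σ z, x ⟶ z := ![⟨x, 𝟙 x⟩, ⟨z', δ⟩, ⟨z, γ⟩]
  -- The weights `1, -2, 1` at the unit, `δ` and `γ` give `2ψ(γ) - 4ψ(δ) - 4ψ(γ⁻¹δ) ≤ 0`.
  have h1 := h.sum_nonpos x hx 3 (by norm_num) (fun i => (p i).1)
    (fun i => by fin_cases i <;> assumption) (fun i => (p i).2) ![1, -2, 1]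
    (by simp [Fin.sum_univ_three]; norm_num)
  have e1 := h.apply_inv_comp_self hx (𝟙 x)
  have e2 := h.apply_inv_comp_self hz γ
  have e3 := h.apply_inv_comp_self hz' δ
  have e4 := h.apply_inv_comp_comm hz hx γ (𝟙 x)
  have e5 := h.apply_inv_comp_comm hz' hx δ (𝟙 x)
  have e6 := h.apply_inv_comp_comm hz' hz δ γ
  have e7 : (⟨x, z, Groupoid.inv (𝟙 x) ≫ γ⟩ : Arr X) = ⟨x, z, γ⟩ := by simp
  have e8 : (⟨x, z', Groupoid.inv (𝟙 x) ≫ δ⟩ : Arr X) = ⟨x, z', δ⟩ := by simp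
  simp only [Fin.sum_univ_three, p, Matrix.cons_val_zero, Matrix.cons_val_one,
    Matrix.cons_val] at h1
  rw [e1, e2, e3, e4, e5, e6, e7, e8] at h1
  linarith

end IsCondNegDefOn

/-- The Schoenberg kernels of a conditionally negative definite function. -/
noncomputable def expKernel (n : ℕ) (r : ℝ) : ℂ := (Real.exp (-(1 / ((n : ℝ) + 1) * r)) : ℂ)

theorem measurable_expKernel (n : ℕ) : Measurable (expKernel n) := by
  unfold expKernel
  fun_prop

theorem expKernel_zero (n : ℕ) : expKernel n 0 = 1 := by simp [expKernel]

theorem tendsto_expKernel (r : ℝ) : Tendsto (fun n => expKernel n r) atTop (𝓝 1) := by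
  have h1 : Tendsto (fun n : ℕ => -(1 / ((n : ℝ) + 1) * r)) atTop (𝓝 0) := by
    simpa using (tendsto_one_div_add_atTop_nhds_zero_nat.mul_const r).neg
  have h2 : Tendsto (fun n => expKernel n r) atTop (𝓝 ((Real.exp 0 : ℝ) : ℂ)) :=
    (Complex.continuous_ofReal.tendsto _).comp ((Real.continuous_exp.tendsto _).comp h1)
  rwa [Real.exp_zero, Complex.ofReal_one] at h2

theorem tendsto_expKernel_atTop (n : ℕ) {r : ℕ → ℝ} (hr : Tendsto r atTop atTop) :
    Tendsto (fun k => expKernel n (r k)) atTop (𝓝 0) := by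
  have hpos : (0 : ℝ) < 1 / ((n : ℝ) + 1) := by positivity
  have h1 := Real.tendsto_exp_neg_atTop_nhds_zero.comp (hr.const_mul_atTop hpos)
  have h2 : Tendsto (fun k => expKernel n (r k)) atTop (𝓝 ((0 : ℝ) : ℂ)) :=
    (Complex.continuous_ofReal.tendsto _).comp h1
  rwa [Complex.ofReal_zero] at h2

end CondNegDef

/-! ### Hilbert bundles from positive semidefinite kernels -/

section KernelBundle

open scoped ComplexOrder

variable {X : Type u} [MeasurableSpace X] [StandardBorelSpace X]

theorem exists_hilbertBundle_of_kernel {K : X → Matrix ℕ ℕ ℂ} (hK : ∀ x, (K x).PosSemidef)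
    (hm : ∀ i j, Measurable fun x => K x i j) :
    ∃ (H : HilbertBundle.{u, v} X) (ζ : ℕ → ∀ x, H.fiber x), IsFundamentalSeq ζ ∧
      ∀ x i j, inner ℂ (ζ i x) (ζ j x) = K x i j := by
  have G : ∀ x, GNS.{v} (K x) := fun x => (nonempty_gns (hK x)).some
  let _ : ∀ x, NormedAddCommGroup (G x).space := fun x => (G x).normed
  let _ : ∀ x, InnerProductSpace ℂ (G x).space := fun x => (G x).innerProduct
  have _ : ∀ x, CompleteSpace (G x).space := fun x => (G x).complete
  obtain ⟨m, h1, h2, h3⟩ := HilbertBundle.exists_of_generating (fun x => (G x).space)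
    (fun k x => (G x).vec k)
    (fun i j => by simpa only [(G _).inner_vec] using hm i j) (fun x => (G x).dense_span)
  exact ⟨{ fiber := fun x => (G x).space
           measurableSet_iff := h2
           exists_fundamental := ⟨_, h3⟩ }, fun k x => (G x).vec k, h3,
    fun x i j => (G x).inner_vec i j⟩

end KernelBundle

/-! ### The representation attached to a conditionally negative definite function -/

section SchoenbergRepresentation

open scoped ComplexOrder

variable {X : Type u} [Groupoid.{w} X] [MeasurableSpace X] [MeasurableSpace (Arr X)]
  [IsBorelGroupoid X]

theorem measurable_arr_comp {Y : Type*} [MeasurableSpace Y] {x y z : Y → X}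
    {a : ∀ t, x t ⟶ y t} {b : ∀ t, y t ⟶ z t}
    (ha : Measurable fun t => (⟨x t, y t, a t⟩ : Arr X))
    (hb : Measurable fun t => (⟨y t, z t, b t⟩ : Arr X)) :
    Measurable fun t => (⟨x t, z t, a t ≫ b t⟩ : Arr X) := by
  have h := (IsBorelGroupoid.measurable_comp (X := X)).comp
    ((ha.prodMk hb).subtype_mk (h := fun t => rfl))
  convert h using 2 with t
  simp [Arr.comp]

theorem measurable_arr_inv {Y : Type*} [MeasurableSpace Y] {x y : Y → X}
    {a : ∀ t, x t ⟶ y t} (ha : Measurable fun t => (⟨x t, y t, a t⟩ : Arr X)) :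
    Measurable fun t => (⟨y t, x t, Groupoid.inv (a t)⟩ : Arr X) :=
  (IsBorelGroupoid.measurable_inverse (X := X)).comp ha

/-- The representation attached to a conditionally negative definite function `ψ`, with vectors
`V n γ` whose Gram matrix is `exp(-ψ/(n+1))` for each `n`. -/
theorem exists_schoenberg_representation [StandardBorelSpace X] [StandardBorelSpace (Arr X)] {ν : Measure (Arr X)}
    {κ : Kernel X (Arr X)} [IsMarkovKernel κ] {U : Set X} (h : IsChargedReduction ν κ U)
    {ψ : Arr X → ℝ} (hψm : Measurable ψ) (hψ : IsCondNegDefOn U ψ) :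
    ∃ (H : HilbertBundle.{u, v} X) (L : Representation ν H)
      (V : ℕ → ∀ {x z : X}, (x ⟶ z) → H.fiber x), L.IsUnitaryOn U ∧
      (∀ n, H.IsBorelSection fun x => V n (𝟙 x)) ∧
      (∀ {x z z' : X}, x ∈ U → z ∈ U → z' ∈ U → ∀ (γ : x ⟶ z) (δ : x ⟶ z') (n m : ℕ),
        inner ℂ (V n γ) (V m δ) =
          if n = m then expKernel n (ψ ⟨z, z', Groupoid.inv γ ≫ δ⟩) else 0) ∧
      (∀ {x z q : X}, x ∈ U → z ∈ U → q ∈ U → ∀ (γ : x ⟶ z) (δ : z ⟶ q) (n : ℕ),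
        L.op γ (V n δ) = V n (γ ≫ δ)) ∧
      ∀ x ∈ U, Dense (Submodule.span ℂ
        {w : H.fiber x | ∃ (n : ℕ) (z : X) (γ : x ⟶ z), z ∈ U ∧ V n γ = w} : Set (H.fiber x)) := by
  classical
  obtain ⟨y, g, hg, hgU', hgsurj⟩ := h.exists_enumeration
    (measurableSet_reduction h.conull.1) subset_rfl
  have hyU : ∀ n, ∀ x ∈ U, y n x ∈ U := fun n x hx =>
    (hgU' n x ⟨Arr.unit x, ⟨hx, hx⟩, rfl⟩).2
  -- The value zero off `U` gives the constant kernel `1` there, so the kernels are positive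
  -- semidefinite over every unit.
  let ψx : X → ℕ → ℕ → ℝ := fun x i j =>
    if x ∈ U then ψ ⟨y i x, y j x, Groupoid.inv (g i x) ≫ g j x⟩ else 0
  have hψx : ∀ i j, Measurable fun x => ψx x i j := fun i j =>
    Measurable.ite h.conull.1
      (hψm.comp (measurable_arr_comp (measurable_arr_inv (hg i)) (hg j))) measurable_const
  have hpos : ∀ x n, (Matrix.of fun i j => expKernel n (ψx x i j)).PosSemidef := by
    intro x n
    by_cases hx : x ∈ U
    · simp only [ψx, if_pos hx]
      refine posSemidef_exp_neg (ψ := fun i j => ψ ⟨y i x, y j x, Groupoid.inv (g i x) ≫ g j x⟩)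
        (fun i => hψ.apply_inv_comp_self (hyU i x hx) _)
        (fun i j => hψ.apply_inv_comp_comm (hyU i x hx) (hyU j x hx) _ _) ?_ (by positivity)
      exact condNegDef_finset (fun i => hψ.apply_inv_comp_self (hyU i x hx) _)
        fun k hk p c hc => hψ.sum_nonpos x hx k hk (fun i => y (p i) x)
          (fun i => hyU _ x hx) (fun i => g (p i) x) c hc
    · simp only [ψx, if_neg hx, expKernel_zero]
      simpa using posSemidef_rankOne (fun _ : ℕ => (1 : ℂ))
  -- An index encodes a position in the enumeration and a scale `n`; different scales are
  -- orthogonal.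
  let K : X → Matrix ℕ ℕ ℂ := fun x => Matrix.of fun a b =>
    if a.unpair.2 = b.unpair.2 then expKernel a.unpair.2 (ψx x a.unpair.1 b.unpair.1) else 0
  obtain ⟨H, ζ, hζ, hgram⟩ := exists_hilbertBundle_of_kernel.{u, v} (K := K)
    (fun x => posSemidef_directSum (hpos x) (fun a : ℕ => a.unpair.2) fun a => a.unpair.1)
    (fun i j => by
      simp only [K, Matrix.of_apply]
      split_ifs
      · exact (measurable_expKernel _).comp (hψx _ _)
      · exact measurable_const)
  have hidx : ∀ a : Arr X, ∃ i, a ∈ Arr.reduction U →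
      (⟨a.rng, y i a.rng, g i a.rng⟩ : Arr X) = a := fun a => by
    by_cases ha : a ∈ Arr.reduction U
    · obtain ⟨i, hi⟩ := hgsurj a ha
      exact ⟨i, fun _ => hi⟩
    · exact ⟨0, fun h => absurd h ha⟩
  choose idx hidx' using hidx
  have hidx : ∀ {x z : X}, x ∈ U → z ∈ U → ∀ (γ : x ⟶ z) (k : ℕ), k = idx ⟨x, z, γ⟩ →
      (⟨x, y k x, g k x⟩ : Arr X) = ⟨x, z, γ⟩ := by
    rintro x z hx hz γ _ rfl
    exact hidx' ⟨x, z, γ⟩ ⟨hx, hz⟩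
  have hleft : ∀ {x z p q : X} (γ : x ⟶ z) {a : z ⟶ p} {b : z ⟶ q},
      (⟨z, p, a⟩ : Arr X) = ⟨z, q, b⟩ → (⟨x, p, γ ≫ a⟩ : Arr X) = ⟨x, q, γ ≫ b⟩ := by
    intro x z p q γ a b h1
    cases h1
    rfl
  let V : ℕ → ∀ {x z : X}, (x ⟶ z) → H.fiber x := fun n {x z} γ =>
    if x ∈ U ∧ z ∈ U then ζ (Nat.pair (idx ⟨x, z, γ⟩) n) x else 0
  have hV : ∀ {x z : X}, x ∈ U → z ∈ U → ∀ (γ : x ⟶ z) (n : ℕ),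
      V n γ = ζ (Nat.pair (idx ⟨x, z, γ⟩) n) x := fun hx hz γ n => if_pos ⟨hx, hz⟩
  have hψ_congr : ∀ {x y y' z z' : X} {a : x ⟶ y} {a' : x ⟶ y'} {b : x ⟶ z} {b' : x ⟶ z'},
      (⟨x, y, a⟩ : Arr X) = ⟨x, y', a'⟩ → (⟨x, z, b⟩ : Arr X) = ⟨x, z', b'⟩ →
      ψ ⟨y, z, Groupoid.inv a ≫ b⟩ = ψ ⟨y', z', Groupoid.inv a' ≫ b'⟩ := by
    intro x y y' z z' a a' b b' h1 h2
    cases h1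
    cases h2
    rfl
  have hζV : ∀ {x z : X}, x ∈ U → z ∈ U → ∀ (k : ℕ) (δ : x ⟶ z) (n : ℕ),
      inner ℂ (ζ k x) (V n δ) = if k.unpair.2 = n then
        expKernel n (ψ ⟨y k.unpair.1 x, z, Groupoid.inv (g k.unpair.1 x) ≫ δ⟩) else 0 := by
    intro x z hx hz k δ n
    rw [hV hx hz, hgram]
    simp only [K, Matrix.of_apply, Nat.unpair_pair, ψx, if_pos hx]
    split_ifs with hk
    · rw [hk]
      congr 1
      exact hψ_congr rfl (hidx hx hz δ _ (by simp))
    · rfl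
  have hVV : ∀ {x z z' : X}, x ∈ U → z ∈ U → z' ∈ U → ∀ (γ : x ⟶ z) (δ : x ⟶ z') (n m : ℕ),
      inner ℂ (V n γ) (V m δ) =
        if n = m then expKernel n (ψ ⟨z, z', Groupoid.inv γ ≫ δ⟩) else 0 := by
    intro x z z' hx hz hz' γ δ n m
    rw [hV hx hz γ, hζV hx hz']
    simp only [Nat.unpair_pair]
    split_ifs with hk
    · rw [hk]
      congr 1
      exact hψ_congr (hidx hx hz γ _ (by simp)) rfl
    · rfl
  -- The enumeration may repeat elements. Indices of the same element and scale give equal vectors,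
  -- having the same inner products with a total family; so the choice of `idx` is immaterial.
  have hζeq : ∀ x ∈ U, ∀ k, ζ k x = V k.unpair.2 (g k.unpair.1 x) := by
    intro x hx k
    refine hζ.separates x _ _ fun l => ?_
    rw [hζV hx (hyU _ x hx), hgram]
    simp only [K, Matrix.of_apply, ψx, if_pos hx]
    split_ifs with hk
    · rw [hk]
    · rfl
  have hV_congr : ∀ (n : ℕ) {x y z : X} {a : x ⟶ y} {b : x ⟶ z},
      (⟨x, y, a⟩ : Arr X) = ⟨x, z, b⟩ → V n a = V n b := by
    intro n x y z a b h1
    cases h1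
    rfl
  -- Left translation by `γ` preserves the Gram matrix, since `(γδ)⁻¹(γδ') = δ⁻¹δ'`, and so extends
  -- to a unitary operator. It is onto because `δ = γ(γ⁻¹δ)`. The value zero off `U` keeps the
  -- coefficients Borel.
  have hop : ∀ {x z : X} (γ : x ⟶ z), ∃ T : H.fiber z →L[ℂ] H.fiber x,
      (x ∈ U → z ∈ U → Isometry T ∧ Function.Surjective T ∧
        ∀ k, T (ζ k z) = V k.unpair.2 (γ ≫ g k.unpair.1 z)) ∧ (¬(x ∈ U ∧ z ∈ U) → T = 0) := by
    intro x z γ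
    by_cases hxz : x ∈ U ∧ z ∈ U
    · obtain ⟨hx, hz⟩ := hxz
      obtain ⟨T, h1, h2, h3⟩ := exists_isometry_of_gram_eq (a := fun k => ζ k z)
        (b := fun k => V k.unpair.2 (γ ≫ g k.unpair.1 z)) (fun i j => by
          rw [hζeq z hz i, hζeq z hz j, hVV hz (hyU _ z hz) (hyU _ z hz),
            hVV hx (hyU _ z hz) (hyU _ z hz)]
          simp) (HilbertBundle.dense_span hζ z)
        ((HilbertBundle.dense_span hζ x).mono (Submodule.span_mono (by
          rintro _ ⟨k, rfl⟩
          refine ⟨Nat.pair (idx ⟨z, _, Groupoid.inv γ ≫ g k.unpair.1 x⟩) k.unpair.2, ?_⟩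
          have hk : ∀ i, (Nat.pair i k.unpair.2).unpair.2 = k.unpair.2 := fun i => by simp
          beta_reduce
          rw [hζeq x hx k, hk]
          apply hV_congr
          rw [hleft γ (hidx hz (hyU _ x hx) (Groupoid.inv γ ≫ g k.unpair.1 x) _ (by simp))]
          simp)))
      exact ⟨T, fun _ _ => ⟨h1, h2, h3⟩, fun hn => absurd ⟨hx, hz⟩ hn⟩
    · exact ⟨0, fun hx hz => absurd ⟨hx, hz⟩ hxz, fun _ => rfl⟩
  choose op hop hop0 using @hop
  have hopV : ∀ {x z q : X}, x ∈ U → z ∈ U → q ∈ U → ∀ (γ : x ⟶ z) (δ : z ⟶ q) (n : ℕ),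
      op γ (V n δ) = V n (γ ≫ δ) := by
    intro x z q hx hz hq γ δ n
    rw [hV hz hq, (hop γ hx hz).2.2]
    rw [show (Nat.pair (idx ⟨z, q, δ⟩) n).unpair.2 = n by simp]
    exact hV_congr _ (hleft γ (hidx hz hq δ _ (by simp)))
  have hcomp : ∀ {x z q : X}, x ∈ U → z ∈ U → q ∈ U → ∀ (γ : x ⟶ z) (δ : z ⟶ q),
      op (γ ≫ δ) = (op γ).comp (op δ) := by
    intro x z q hx hz hq γ δ
    refine continuousLinearMap_ext_of_dense (HilbertBundle.dense_span hζ q) fun k => ?_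
    rw [ContinuousLinearMap.comp_apply, hζeq q hq k, hopV hx hq (hyU _ q hq),
      hopV hz hq (hyU _ q hq), hopV hx hz (hyU _ q hq), Category.assoc]
  have hmeas : ∀ m n, Measurable fun a : Arr X => inner ℂ (op a.hom (ζ n a.src)) (ζ m a.rng) := by
    intro m n
    have h1 : (fun a : Arr X => inner ℂ (op a.hom (ζ n a.src)) (ζ m a.rng)) = fun a =>
        if a ∈ Arr.reduction U then (if n.unpair.2 = m.unpair.2 then
          expKernel n.unpair.2 (ψ ⟨_, _, Groupoid.inv (a.hom ≫ g n.unpair.1 a.src) ≫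
            g m.unpair.1 a.rng⟩) else 0) else 0 := by
      ext a
      by_cases ha : a ∈ Arr.reduction U
      · rw [if_pos ha, hζeq _ ha.2 n, hζeq _ ha.1 m, hopV ha.1 ha.2 (hyU _ _ ha.2),
          hVV ha.1 (hyU _ _ ha.2) (hyU _ _ ha.1)]
      · rw [if_neg ha, hop0 a.hom ha]
        simp
    rw [h1]
    refine Measurable.ite (measurableSet_reduction h.conull.1) ?_ measurable_const
    split_ifs
    · refine (measurable_expKernel _).comp (hψm.comp ?_)
      exact measurable_arr_comp (measurable_arr_inv (measurable_arr_comp (Y := Arr X)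
        (x := Arr.rng) (y := Arr.src) (a := fun a => a.hom) measurable_id
        ((hg _).comp measurable_src))) ((hg _).comp measurable_rng)
    · exact measurable_const
  refine ⟨H, ⟨op, ⟨ζ, hζ, hmeas⟩, U, h.conull,
    fun x hx z hz γ => ⟨(hop γ hx hz).1, (hop γ hx hz).2.1⟩,
    fun x hx z hz q hq γ δ => hcomp hx hz hq γ δ⟩, V,
    ⟨fun hx hz γ => (hop γ hx hz).1, fun hx hz γ => (hop γ hx hz).2.1, hcomp⟩,
    fun n => ?_, hVV, hopV, fun x hx => ?_⟩
  · refine (HilbertBundle.measurable_mk_iff (f := id) measurable_id hζ).2 fun k => ?_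
    have h1 : (fun x => inner ℂ (ζ k x) (V n (𝟙 x))) = fun x => if x ∈ U then
        (if k.unpair.2 = n then expKernel n (ψ ⟨y k.unpair.1 x, x,
          Groupoid.inv (g k.unpair.1 x)⟩) else 0) else 0 := by
      ext x
      by_cases hx : x ∈ U
      · rw [if_pos hx, hζV hx hx]
        simp
      · have : V n (𝟙 x) = 0 := if_neg fun hn => hx hn.1
        rw [if_neg hx, this, inner_zero_right]
    change Measurable fun x => inner ℂ (ζ k x) (V n (𝟙 x))
    rw [h1]
    refine Measurable.ite h.conull.1 ?_ measurable_const
    split_ifs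
    · exact (measurable_expKernel _).comp (hψm.comp (measurable_arr_inv (hg _)))
    · exact measurable_const
  · refine (HilbertBundle.dense_span hζ x).mono (Submodule.span_mono ?_)
    rintro _ ⟨k, rfl⟩
    exact ⟨_, _, _, hyU _ x hx, (hζeq x hx k).symm⟩

end SchoenbergRepresentation

/-! ### Weak convergence of bounded sequences -/

section WeakLimit

theorem tendsto_inner_zero_of_dense {E : Type*} [NormedAddCommGroup E] [InnerProductSpace ℂ E]
    {u : ℕ → E} (hu : ∀ k, ‖u k‖ ≤ 1) {S : Set E} (hS : Dense (Submodule.span ℂ S : Set E))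
    (h : ∀ w ∈ S, Tendsto (fun k => inner ℂ (u k) w) atTop (𝓝 0)) (w : E) :
    Tendsto (fun k => inner ℂ (u k) w) atTop (𝓝 0) := by
  have hspan : ∀ w ∈ Submodule.span ℂ S, Tendsto (fun k => inner ℂ (u k) w) atTop (𝓝 0) := by
    intro w hw
    induction hw using Submodule.span_induction with
    | mem w hw => exact h w hw
    | zero => simp
    | add x y _ _ hx hy => simpa [inner_add_right] using hx.add hy
    | smul c x _ hx => simpa [inner_smul_right] using hx.const_mul c
  rw [Metric.tendsto_atTop]
  intro ε hε
  obtain ⟨s, hs, hd⟩ := hS.exists_dist_lt w (half_pos hε)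
  obtain ⟨N, hN⟩ := Metric.tendsto_atTop.1 (hspan s hs) (ε / 2) (half_pos hε)
  refine ⟨N, fun k hk => ?_⟩
  have h1 := hN k hk
  rw [dist_zero_right] at h1 ⊢
  have h2 : inner ℂ (u k) w = inner ℂ (u k) (w - s) + inner ℂ (u k) s := by
    rw [← inner_add_right, sub_add_cancel]
  rw [h2]
  have h3 : ‖inner ℂ (u k) (w - s)‖ ≤ ‖w - s‖ :=
    (norm_inner_le_norm _ _).trans (mul_le_of_le_one_left (norm_nonneg _) (hu k))
  rw [dist_eq_norm] at hd
  linarith [norm_add_le (inner ℂ (u k) (w - s)) (inner ℂ (u k) s)]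

end WeakLimit

/-! ### From property T to fibrewise boundedness -/

section PropertyT

variable {X : Type u} [Groupoid.{w} X] [MeasurableSpace X] [StandardBorelSpace X]
  [MeasurableSpace (Arr X)] [StandardBorelSpace (Arr X)] [IsBorelGroupoid X]
  {ν : Measure (Arr X)}

theorem exists_fibrewise_bounded_of_propertyT [IsProbabilityMeasure ν]
    (hν : IsMeasuredGroupoid ν) (hdisc : IsRDiscrete ν) (hT : PropertyT.{u, v, w} ν)
    {ψ : Arr X → ℝ} (hψ : IsCondNegDef ν ψ) :
    ∃ E : Set X, MeasurableSet E ∧ 0 < unitMeasure ν E ∧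
      ∀ x ∈ E, BddAbove {t : ℝ | ∃ γ : Arr X, γ.rng = x ∧ γ.src ∈ E ∧ t = |ψ γ|} := by
  obtain ⟨κ, hκ, U₀, hU₀⟩ := exists_isChargedReduction hν hdisc
  obtain ⟨U₁, hU₁, hψ1, hψ2, hψ3⟩ := hψ.exists_reduction
  have hch := hU₀.mono (hU₀.conull.inter hU₁) Set.inter_subset_left
  have hcnd : IsCondNegDefOn (U₀ ∩ U₁) ψ :=
    IsCondNegDefOn.mono ⟨hψ1, hψ2, hψ3⟩ Set.inter_subset_right
  generalize U₀ ∩ U₁ = U at hch hcnd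
  obtain ⟨H, L, V, hL, hVB, hVV, hLV, hdense⟩ :=
    exists_schoenberg_representation.{u, v} hch hψ.measurable hcnd
  have hnorm : ∀ {x z : X}, x ∈ U → z ∈ U → ∀ (γ : x ⟶ z) (n : ℕ), ‖V n γ‖ = 1 := by
    intro x z hx hz γ n
    have h1 := hVV hx hz hz γ γ n n
    rw [if_pos rfl, hcnd.apply_inv_comp_self hz, expKernel_zero] at h1
    have h2 := inner_self_eq_norm_sq (𝕜 := ℂ) (V n γ)
    rw [h1, RCLike.re_to_complex, Complex.one_re] at h2
    exact (pow_eq_one_iff_of_nonneg (norm_nonneg _) two_ne_zero).1 h2.symm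
  have hunit : ∀ n, IsUnitSection ν H fun x => V n (𝟙 x) := fun n => ⟨hVB n, by
    filter_upwards [show ∀ᵐ x ∂unitMeasure ν, x ∈ U from hch.conull.2] with x hx
    exact hnorm hx hx (𝟙 x) n⟩
  have hred : ∀ᵐ a ∂ν, a ∈ Arr.reduction U := hch.conull.measure_reduction_compl hν.symmetric
  have hlim : ∀ᵐ a ∂ν, Tendsto (fun n => L.cobdry (fun x => V n (𝟙 x)) a) atTop (𝓝 0) := by
    filter_upwards [hred] with a haU
    have hin : ∀ n, ‖L.cobdry (fun x => V n (𝟙 x)) a‖ ^ 2 =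
        2 - 2 * (expKernel n (ψ a)).re := by
      intro n
      have h1 := hVV haU.1 haU.1 haU.2 (𝟙 a.rng) a.hom n n
      have h2 : (⟨a.rng, a.src, Groupoid.inv (𝟙 a.rng) ≫ a.hom⟩ : Arr X) = a := by simp
      rw [if_pos rfl, h2] at h1
      simp only [Representation.cobdry]
      rw [hLV haU.1 haU.2 haU.2, Category.comp_id, norm_sub_sq (𝕜 := ℂ), h1,
        hnorm haU.1 haU.1, hnorm haU.1 haU.2]
      simp only [RCLike.re_to_complex]
      ring
    rw [tendsto_zero_iff_norm_tendsto_zero]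
    have h3 : Tendsto (fun n => ‖L.cobdry (fun x => V n (𝟙 x)) a‖ ^ 2) atTop (𝓝 0) := by
      simp only [hin]
      have h4 := (Complex.continuous_re.tendsto _).comp (tendsto_expKernel (ψ a))
      have h5 := (h4.const_mul 2).const_sub 2
      simpa using h5
    simpa [Real.sqrt_sq] using h3.sqrt
  obtain ⟨η, ⟨hηB, hη1⟩, hηinv⟩ := hT H L ⟨fun n x => V n (𝟙 x), hunit, hlim⟩
  -- Invariance and unitarity make the coefficient of `η` along `V n γ` depend only on the source of
  -- `γ`.
  have hpair : ∀ {x z : X}, x ∈ U → z ∈ U → ∀ γ : x ⟶ z, L.cobdry η ⟨x, z, γ⟩ = 0 → ∀ n,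
      inner ℂ (V n γ) (η x) = inner ℂ (V n (𝟙 z)) (η z) := by
    intro x z hx hz γ h0 n
    have h1 : η x = L.op γ (η z) := sub_eq_zero.1 h0
    have h2 := hLV hx hz hz γ (𝟙 z) n
    rw [Category.comp_id] at h2
    rw [h1, ← h2, isometry_inner_map_map (hL.isometry hx hz γ)]
  obtain ⟨W, hW, hW1⟩ := exists_isConullUnits_of_ae hη1
  obtain ⟨U', hU'U, hU', hinv⟩ := hch.exists_forall_of_ae hηinv
  have hm : ∀ n, Measurable fun x => ‖inner ℂ (V n (𝟙 x)) (η x)‖ := fun n =>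
    (HilbertBundle.measurable_inner (f := id) measurable_id (hVB n) hηB).norm
  let E : ℕ × ℕ → Set X := fun q =>
    U' ∩ {x | 1 / ((q.2 : ℝ) + 1) ≤ ‖inner ℂ (V q.1 (𝟙 x)) (η x)‖}
  have hE : ∀ q, MeasurableSet (E q) := fun q =>
    hU'.1.inter (measurableSet_le measurable_const (hm q.1))
  -- If all these level sets were null, then by symmetry some unit `x` would have only elements
  -- whose sources have vanishing coefficients. Then `η x` would be orthogonal to a total family,
  -- against `‖η x‖ = 1`.
  have hEpos : ∃ q, 0 < unitMeasure ν (E q) := by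
    by_contra! hcon
    have hnull : unitMeasure ν ((⋃ q, E q) ∪ U'ᶜ) = 0 :=
      measure_union_null (measure_iUnion_null fun q => le_antisymm (hcon q) bot_le) hU'.2
    have hZm : MeasurableSet ((⋃ q, E q) ∪ U'ᶜ) :=
      (MeasurableSet.iUnion hE).union hU'.1.compl
    have hsrc := (hν.symmetric.measure_src_preimage_eq_zero_iff hZm).2 hnull
    obtain ⟨U'', hU''U, hU'', hZ⟩ := hch.exists_forall_of_ae (measure_eq_zero_iff_ae_notMem.1 hsrc)
    have hall := (hU''.inter hU').inter hW
    have hne : ((U'' ∩ U') ∩ W).Nonempty := by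
      rw [Set.nonempty_iff_ne_empty]
      intro hemp
      have h1 := hall.2
      rw [hemp, Set.compl_empty, unitMeasure_apply MeasurableSet.univ, Set.preimage_univ,
        measure_univ] at h1
      exact one_ne_zero h1
    obtain ⟨x, ⟨hx'', hx'⟩, hxW⟩ := hne
    have hxU := hU'U hx'
    have hzero : ∀ w ∈ {w : H.fiber x | ∃ (n : ℕ) (z : X) (γ : x ⟶ z), z ∈ U ∧ V n γ = w},
        Tendsto (fun _ : ℕ => inner ℂ (η x) w) atTop (𝓝 0) := by
      rintro _ ⟨n, z, γ, hz, rfl⟩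
      have h1 : z ∉ (⋃ q, E q) ∪ U'ᶜ := hZ ⟨x, z, γ⟩ hx'' hz
      have h2 : inner ℂ (V n (𝟙 z)) (η z) = 0 := by
        by_contra h3
        obtain ⟨k, hk⟩ := exists_nat_one_div_lt (norm_pos_iff.2 h3)
        have hzU' : z ∈ U' := by
          by_contra h4
          exact h1 (Or.inr h4)
        exact h1 (Or.inl (Set.mem_iUnion.2 ⟨(n, k), hzU', hk.le⟩))
      have h3 : inner ℂ (η x) (V n γ) = 0 := by
        rw [← inner_conj_symm, hpair hxU hz γ (hinv ⟨x, z, γ⟩ hx' hz), h2, map_zero]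
      rw [h3]
      exact tendsto_const_nhds
    have h4 := tendsto_inner_zero_of_dense (u := fun _ => η x) (fun _ => (hW1 x hxW).le)
      (hdense x hxU) hzero (η x)
    have h5 := tendsto_nhds_unique tendsto_const_nhds h4
    rw [inner_self_eq_zero] at h5
    have h6 := hW1 x hxW
    rw [h5, norm_zero] at h6
    exact zero_ne_one h6
  obtain ⟨⟨n, k⟩, hpos⟩ := hEpos
  refine ⟨E (n, k), hE _, hpos, fun x hx => ?_⟩
  have hxU := hU'U hx.1
  by_contra hunb
  rw [not_bddAbove_iff] at hunb
  have hseq : ∀ j : ℕ, ∃ (z : X) (γ : x ⟶ z), z ∈ E (n, k) ∧ (j : ℝ) < ψ ⟨x, z, γ⟩ := by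
    intro j
    obtain ⟨t, ⟨⟨x', z, γ⟩, hr, hz, rfl⟩, ht⟩ := hunb j
    obtain rfl : x' = x := hr
    rw [abs_of_nonneg (hcnd.nonneg hxU (hU'U hz.1) γ)] at ht
    exact ⟨z, γ, hz, ht⟩
  choose z γ hz hγ using hseq
  have hzU : ∀ j, z j ∈ U := fun j => hU'U (hz j).1
  -- When `ψ(γ_j)` tends to infinity, so does `ψ(γ_j⁻¹δ)` for each fixed `δ`, by the quasi-triangle
  -- inequality; hence the vectors `V n (γ_j)` tend weakly to zero.
  have hlim := tendsto_inner_zero_of_dense (u := fun j => V n (γ j))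
    (fun j => (hnorm hxU (hzU j) (γ j) n).le) (hdense x hxU) (by
      rintro _ ⟨m, q, δ, hq, rfl⟩
      simp only [hVV hxU (hzU _) hq]
      split_ifs with hnm
      · refine tendsto_expKernel_atTop n (tendsto_atTop_mono (f := fun j : ℕ =>
          (1 / 2 : ℝ) * (j : ℝ) + -ψ ⟨x, q, δ⟩) (fun j => ?_) (tendsto_atTop_add_const_right _ _
            (tendsto_natCast_atTop_atTop.const_mul_atTop (by norm_num))))
        have h1 := hcnd.apply_le hxU (hzU j) hq (γ j) δ
        linarith [hγ j]
      · exact tendsto_const_nhds) (η x)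
  have hlow : ∀ j, 1 / ((k : ℝ) + 1) ≤ ‖inner ℂ (V n (γ j)) (η x)‖ := by
    intro j
    rw [hpair hxU (hzU j) (γ j) (hinv ⟨x, z j, γ j⟩ hx.1 (hzU j))]
    exact (hz j).2
  have h1 := ge_of_tendsto' hlim.norm hlow
  rw [norm_zero] at h1
  have h2 : (0 : ℝ) < 1 / ((k : ℝ) + 1) := by positivity
  linarith

end PropertyT

end MeasGpd

open MeasGpd in
theorem theorem5 {X : Type u} [Groupoid.{w} X] [MeasurableSpace X] [StandardBorelSpace X]
    [MeasurableSpace (Arr X)] [StandardBorelSpace (Arr X)] [IsBorelGroupoid X]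
    (ν : Measure (Arr X)) [IsProbabilityMeasure ν] (hν : IsMeasuredGroupoid ν)
    (herg : IsErgodic ν) (hdisc : IsRDiscrete ν) :
    List.TFAE [
      PropertyT.{u, v, w} ν,
      ∀ ψ : Arr X → ℝ, IsCondNegDef ν ψ →
        ∃ E : Set X, MeasurableSet E ∧ 0 < unitMeasure ν E ∧
          ∃ M : ℝ, ∀ γ ∈ Arr.reduction E, |ψ γ| ≤ M,
      ∀ ψ : Arr X → ℝ, IsCondNegDef ν ψ →
        ∃ E : Set X, MeasurableSet E ∧ 0 < unitMeasure ν E ∧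
          ∀ x ∈ E, BddAbove {t : ℝ | ∃ γ : Arr X, γ.rng = x ∧ γ.src ∈ E ∧ t = |ψ γ|}] := by
  tfae_have 1 → 3 := fun hT ψ hψ => exists_fibrewise_bounded_of_propertyT hν hdisc hT hψ
  tfae_have 3 → 2 := by
    intro h3 ψ hψ
    obtain ⟨E, hE, hpos, hbdd⟩ := h3 ψ hψ
    obtain ⟨κ, hκ, U, hU⟩ := exists_isChargedReduction hν hdisc
    exact exists_bounded_of_fibrewise_bounded hU hψ.measurable hE hpos hbdd
  tfae_have 2 → 1 := propertyT_of_bounded hν herg hdisc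
  tfae_finish
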